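/- **Setting.** Let $\mathcal C$ be a set of $n$ candidates and let $\mathcal S_n$ be the set of orderings (permutations) of $\mathcal C$. A qualification ordering $\sigma=(\sigma_1,\dots,\sigma_n)\in\mathcal S_n$ lists the candidates from best to worst. A time ordering $\tau=(\tau_1,\dots,\tau_n)$, chosen uniformly at random among all orderings of $\mathcal C$, gives the order in which they appear. If a stopping algorithm $M$ stops at time $M(\sigma,\tau)$, which may depend only on the relative ranks of the candidates seen so far, it selects $CM(\sigma,\tau)=\tau_{M(\sigma,\tau)}$. Let $t_n$ be the smallest integer $t\ge 1$ with $\frac1t+\frac1{t+1}+\dots+\frac1{n-1}\le 1$. The optimal algorithm $M^*$ for the secretary problem stops at the first time $k\ge t_n$ at which $\tau_k$ is the best of $\tau_1,\dots,\tau_k$, and at time $n$ if there is no such $k$. The blind choice $\tilde M$ always selects $\tau_1$. For $p\in[0,1]$ the secretary $p$-mix $M$ tosses a coin, independent of $\tau$, and plays $M^*$ with probability $p$ and $\tilde M$ with probability $1-p$. Put $$r_{k,n}=\mathbb P[CM^*(\sigma,\tau)=\sigma_k],\qquad a_k=\sum_{s=k}^{\infty}\frac1s\Bigl(1-\frac1e\Bigr)^s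 .$$ For $1\le l\le n-1$ let $d_l(\sigma,\rho)$ be the least $k$ such that $\sigma$ can be obtained from $\rho$ by $k$ successive transpositions, each exchanging two elements that are at most $l$ positions apart in the current ordering. A randomized stopping algorithm $M$ is $(\varepsilon,\delta)$-DP with respect to $d_l$ if for all $S\subseteq\mathcal C$ and all $\sigma,\rho\in\mathcal S_n$ with $d_l(\sigma,\rho)\le 1$, $$\mathbb P[CM(\sigma,\tau)\in S]\le e^{\varepsilon}\,\mathbb P[CM(\rho,\tau)\in S]+\delta .$$ **Statement.** Let $l\ge1$ be a constant integer, $\varepsilon\ge 0$ and $\delta\in[0,1]$. For every $n$ fix $\sigma\in\mathcal S_n$ and write $$B_n=\frac{\delta+\frac1n(e^{\varepsilon}-1)}{r_{1,n}-e^{\varepsilon}r_{l+1,n}+\frac1n(e^{\varepsilon}-1)} .$$ 1. Let $n\ge 7$, $l\le n-1$ and $p\in[0,1]$. If either $\delta<r_{1,n}-e^{\varepsilon}r_{l+1,n}$ and $p\le B_n$, or $\delta\ge r_{1,n}-e^{\varepsilon}r_{l+1,n}$ (and $p\le 1$ is arbitrary), then the secretary $p$-mix is $(\varepsilon,\delta)$-DP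 with respect to $d_l$. 2. If $\delta>0$ and $\delta<r_{1,n}-e^{\varepsilon}r_{l+1,n}$ holds for infinitely many $n$, then $1-e^{\varepsilon}a_{l+1}>0$ and $$B_n\sim\frac{e\,\delta}{1-e^{\varepsilon}a_{l+1}}\qquad(n\to\infty),$$ that is, the ratio of the two sides tends to $1$. 3. More generally, for every $\delta\in[0,1]$ (including $\delta=0$), if $e^{\varepsilon}a_{l+1}\ne1$, then $\displaystyle\lim_{n\to\infty}B_n=\frac{e\,\delta}{1-e^{\varepsilon}a_{l+1}}$. -/

import Mathlib

open Filter Topology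
open scoped NNReal

noncomputable section

namespace Secretary

variable {n : ℕ}

/-- The time-`k` candidate (times start at `0`) is the best one seen so far.  Candidates are the
elements of `Fin n`; a qualification ordering `σ` lists them from best (`σ 0`) to worst, so that
`σ.symm c` is the (0-based) rank of `c`; a time ordering `τ` lists them in order of appearance. -/
def IsRecord (σ τ : Equiv.Perm (Fin n)) (k : Fin n) : Prop :=
  ∀ j, j < k → σ.symm (τ k) < σ.symm (τ j)

/-- A stopping time: a function of the two orderings whose value `t` is determined by the
qualification order induced on the candidates that have appeared up to time `t`. -/
structure StoppingTime (n : ℕ) where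
  /-- the (0-based) time at which the algorithm ends the game -/
  time : Equiv.Perm (Fin n) → Equiv.Perm (Fin n) → Fin n
  /-- no dependence on the future -/
  nonanticipating : ∀ σ τ σ' τ' : Equiv.Perm (Fin n),
    (∀ i j, i ≤ time σ τ → j ≤ time σ τ →
      (σ.symm (τ i) < σ.symm (τ j) ↔ σ'.symm (τ' i) < σ'.symm (τ' j))) →
    time σ' τ' = time σ τ

/-- The law of the candidate `τ (M σ τ)` selected by `M`, for a uniformly random time ordering. -/
def StoppingTime.law (M : StoppingTime n) (σ : Equiv.Perm (Fin n)) : PMF (Fin n) :=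
  (PMF.uniformOfFintype (Equiv.Perm (Fin n))).map fun τ => τ (M.time σ τ)

/-- A randomized stopping algorithm draws a stopping time, independently of the time ordering, and
plays according to it. This is the law of the candidate it selects. -/
def randomizedLaw (A : PMF (StoppingTime n)) (σ : Equiv.Perm (Fin n)) : PMF (Fin n) :=
  A.bind fun M => M.law σ

/-- The threshold: the smallest positive integer `t` with `1/t + 1/(t+1) + ⋯ + 1/(n-1) ≤ 1`. -/
def threshold (n : ℕ) : ℕ :=
  sInf {t : ℕ | 1 ≤ t ∧ ∑ i ∈ Finset.Ico t n, (1 : ℝ) / i ≤ 1}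

/-- The (0-based) time `k` is at or after the threshold, and its candidate is a record. -/
def Acceptable (σ τ : Equiv.Perm (Fin n)) (k : Fin n) : Prop :=
  threshold n ≤ (k : ℕ) + 1 ∧ IsRecord σ τ k

open Classical in
/-- The optimal rule: select at the first acceptable time, or at the last time if there is none. -/
def optimalStop [NeZero n] (σ τ : Equiv.Perm (Fin n)) : Fin n :=
  if h : ∃ k, Acceptable σ τ k then Fin.find (Acceptable σ τ) h
  else ⟨n - 1, Nat.sub_lt (NeZero.pos n) one_pos⟩

theorem acceptable_congr {σ τ σ' τ' : Equiv.Perm (Fin n)} {t : Fin n}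
    (h : ∀ i j, i ≤ t → j ≤ t →
      (σ.symm (τ i) < σ.symm (τ j) ↔ σ'.symm (τ' i) < σ'.symm (τ' j)))
    {k : Fin n} (hk : k ≤ t) : Acceptable σ τ k ↔ Acceptable σ' τ' k := by
  unfold Acceptable IsRecord
  refine and_congr_right fun _ => forall₂_congr fun j hj => ?_
  exact h k j hk (hj.le.trans hk)

/-- The optimal algorithm for the secretary problem. -/
def optimal (n : ℕ) [NeZero n] : StoppingTime n where
  time := optimalStop
  nonanticipating := by
    classical
    intro σ τ σ' τ' h
    by_cases hex : ∃ k, Acceptable σ τ k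
    · have hs : optimalStop σ τ = Fin.find (Acceptable σ τ) hex := by
        simp only [optimalStop, hex, dif_pos]
      rw [hs] at h ⊢
      have h1 := (acceptable_congr h le_rfl).1 (Fin.find_spec hex)
      have hex' : ∃ k, Acceptable σ' τ' k := ⟨_, h1⟩
      have hs' : optimalStop σ' τ' = Fin.find (Acceptable σ' τ') hex' := by
        simp only [optimalStop, hex', dif_pos]
      rw [hs']
      refine le_antisymm (Fin.find_le_of_pos hex' h1) ?_
      exact Fin.find_le_of_pos hex ((acceptable_congr h
        (Fin.find_le_of_pos hex' h1)).2 (Fin.find_spec hex'))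
    · have hs : optimalStop σ τ = ⟨n - 1, Nat.sub_lt (NeZero.pos n) one_pos⟩ := by
        simp only [optimalStop, hex, dif_neg, not_false_eq_true]
      have hle : ∀ k : Fin n, k ≤ optimalStop σ τ := by
        intro k
        rw [hs, Fin.le_def]
        have := k.2
        simp only
        omega
      have hex' : ¬ ∃ k, Acceptable σ' τ' k := fun ⟨k, hk⟩ =>
        hex ⟨k, (acceptable_congr h (hle k)).2 hk⟩
      simp only [optimalStop, hex, hex', dif_neg, not_false_eq_true]

/-- The blind choice: always select the first candidate. -/
def blind (n : ℕ) [NeZero n] : StoppingTime n where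
  time := fun _ _ => 0
  nonanticipating := fun _ _ _ _ _ => rfl

/-- A coin that comes down heads (`true`) with probability `p`. -/
def coin (p : ℝ≥0) (hp : p ≤ 1) : PMF Bool :=
  PMF.ofFintype (fun heads => if heads then (p : ENNReal) else ((1 - p : ℝ≥0) : ENNReal)) (by
    simp only [Fintype.sum_bool, if_true, Bool.false_eq_true, if_false]
    rw [← ENNReal.coe_add, add_tsub_cancel_of_le hp, ENNReal.coe_one])

/-- The `p`-mix: toss a coin with heads probability `p`, and play `M₁` on heads, `M₂` on tails. -/
def pMix (p : ℝ≥0) (hp : p ≤ 1) (M₁ M₂ : StoppingTime n) : PMF (StoppingTime n) :=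
  (coin p hp).map fun heads => if heads then M₁ else M₂

/-- `SwapChain l k ρ σ`: `σ` arises from `ρ` by composing with `k` successive transpositions, each
of two elements that are at most `l` positions apart in the permutation reached so far. -/
inductive SwapChain (l : ℕ) : ℕ → Equiv.Perm (Fin n) → Equiv.Perm (Fin n) → Prop
  | refl (ρ : Equiv.Perm (Fin n)) : SwapChain l 0 ρ ρ
  | step {k : ℕ} {ρ σ : Equiv.Perm (Fin n)} (i j : Fin n) (hij : i < j)
      (hl : (j : ℕ) ≤ (i : ℕ) + l) (h : SwapChain l k ρ σ) :
      SwapChain l (k + 1) ρ (Equiv.swap (σ i) (σ j) * σ)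

/-- The `l`-distance on permutations. -/
def lDist (l : ℕ) (σ ρ : Equiv.Perm (Fin n)) : ℕ :=
  sInf {k : ℕ | SwapChain l k ρ σ}

/-- For `l ≥ 1` the set whose minimum defines the `l`-distance is nonempty. -/
theorem exists_swapChain {l : ℕ} (hl : 1 ≤ l) (σ ρ : Equiv.Perm (Fin n)) :
    ∃ k, SwapChain l k ρ σ := by
  obtain _ | m := n
  · exact ⟨0, Subsingleton.elim ρ σ ▸ SwapChain.refl ρ⟩
  · suffices H : ∀ π : Equiv.Perm (Fin (m + 1)), ∀ ρ : Equiv.Perm (Fin (m + 1)),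
        ∀ k₀ ρ₀, SwapChain l k₀ ρ₀ ρ → ∃ k, SwapChain l k ρ₀ (ρ * π) by
      simpa using H (ρ⁻¹ * σ) ρ 0 ρ (SwapChain.refl ρ)
    intro π
    have hπ : π ∈ Submonoid.closure
        (Set.range fun i : Fin m => Equiv.swap i.castSucc i.succ) := by
      rw [Equiv.Perm.mclosure_swap_castSucc_succ]; trivial
    induction hπ using Submonoid.closure_induction with
    | mem x hx =>
      obtain ⟨i, rfl⟩ := hx
      intro ρ k₀ ρ₀ h
      refine ⟨k₀ + 1, ?_⟩
      have := SwapChain.step (l := l) i.castSucc i.succ i.castSucc_lt_succ (by simp; omega) h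
      rwa [← Equiv.mul_swap_eq_swap_mul] at this
    | one => intro ρ k₀ ρ₀ h; exact ⟨k₀, by simpa using h⟩
    | mul x y _ _ hx hy =>
      intro ρ k₀ ρ₀ h
      obtain ⟨k₁, h₁⟩ := hx ρ k₀ ρ₀ h
      obtain ⟨k₂, h₂⟩ := hy _ k₁ ρ₀ h₁
      exact ⟨k₂, by rwa [mul_assoc] at h₂⟩

/-- The probability of the event `S` under the law `P`, as a real number. -/
def prob (P : PMF (Fin n)) (S : Set (Fin n)) : ℝ := (P.toOuterMeasure S).toReal

/-- `(ε, δ)`-differential privacy of a randomized stopping algorithm with respect to a distance `d`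
on the qualification orderings. -/
def IsDP (d : Equiv.Perm (Fin n) → Equiv.Perm (Fin n) → ℝ) (ε δ : ℝ)
    (A : PMF (StoppingTime n)) : Prop :=
  ∀ (S : Set (Fin n)) (σ ρ : Equiv.Perm (Fin n)), d σ ρ ≤ 1 →
    prob (randomizedLaw A σ) S ≤ Real.exp ε * prob (randomizedLaw A ρ) S + δ

/-- `r σ k`: the probability that the optimal algorithm selects the `k`-th best candidate
(`k = 1` is the best one; the value is `0` unless `1 ≤ k ≤ n`). -/
def r [NeZero n] (σ : Equiv.Perm (Fin n)) (k : ℕ) : ℝ :=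
  prob ((optimal n).law σ) {c | ((σ.symm c : Fin n) : ℕ) + 1 = k}

/-- `a k = ∑_{s ≥ k} (1/s) (1 - 1/e)^s`. -/
def a (k : ℕ) : ℝ :=
  ∑' s : ℕ, (1 / ((k + s : ℕ) : ℝ)) * (1 - 1 / Real.exp 1) ^ (k + s)

/-- The series defining `a k` converges. -/
theorem summable_a (k : ℕ) :
    Summable fun s : ℕ => (1 / ((k + s : ℕ) : ℝ)) * (1 - 1 / Real.exp 1) ^ (k + s) := by
  have he : 1 < Real.exp 1 := Real.one_lt_exp_iff.2 one_pos
  have h1 : 0 < 1 / Real.exp 1 := by positivity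
  have h2 : 1 / Real.exp 1 < 1 := by rw [div_lt_one (by positivity)]; exact he
  have h0 : (0 : ℝ) ≤ 1 - 1 / Real.exp 1 := by linarith
  have hg : Summable fun s : ℕ => (1 - 1 / Real.exp 1) ^ (k + s) := by
    simp_rw [pow_add]
    exact (summable_geometric_of_lt_one h0 (by linarith)).mul_left _
  refine Summable.of_nonneg_of_le (fun s => by positivity) (fun s => ?_) hg
  refine mul_le_of_le_one_left (by positivity) ?_
  rcases Nat.eq_zero_or_pos (k + s) with h | h
  · simp [h]
  · rw [div_le_one (by exact_mod_cast h)]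
    exact_mod_cast h

/-- The bound `(δ + (e^ε - 1)/n) / (r_{1,n} - e^ε r_{l+1,n} + (e^ε - 1)/n)`. -/
def pBound [NeZero n] (σ : Equiv.Perm (Fin n)) (l : ℕ) (ε δ : ℝ) : ℝ :=
  (δ + (Real.exp ε - 1) / n) /
    (r σ 1 - Real.exp ε * r σ (l + 1) + (Real.exp ε - 1) / n)

end Secretary

end

/-! The law of the selected candidate depends only on ranks: the mix picks 0-based rank `m` with
probability `q m`, where `q` mixes the decreasing law `selection N` of the optimal rule with the
uniform law. Orderings at `l`-distance at most 1 agree or differ by exchanging ranks `i < j ≤ i +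
l`, and only the candidate promoted to rank `i` can cost privacy. So it suffices that `q i - e^ε * q
j ≤ δ` for all such `i`, `j`. For `i = 0`, `j = l` this is linear in `p` and follows from the
assumed bound. That this pair is the worst follows from `q m * q l ≤ q 0 * q (m + l)`
(`mixSelection_mul_le`), a consequence of log-convexity of `selection N` that survives mixing.

Let `n = N + 1`, `T = t_n - 1`, `K = N - T + 1`. Counting permutations gives `selection N m = T / n
* b m` with `b = rankWeight N T`. Its decrements are `b m - b (m + 1) = g (m + 1)` with `g = gap N
K`, except at `m = 0`. Hence for `k ≥ 2` log-convexity of `b` at `k` reads `g k * g (k + 1) ≤ b k *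
(g k - g (k + 1))`. This is proved by downward induction (`gap_mul_gap_le`): where `g` is itself
log-convex the inequality descends, and elsewhere `N ≤ 3 T` makes `g` so small that `b ≥ 1 / N`
suffices. The exceptional first decrement is treated apart (`rankWeight_one_sq_le`), using `b 0 >
1`, which is the minimality of `t_n`.

For the limits, comparing harmonic sums with logarithms gives `T / N → 1 / e`. Then `g m → (1 -
1/e)^m / m` and `b 0 → 1 = a 1`, so `b m → a (m + 1)` by telescoping and `r_{k,n} → a k / e`. -/

namespace Secretary

/-! ### The rank weights and their decrements -/

/-- Rescaled law of the rank of the selected candidate: with `n = N + 1` candidates, of which the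
first `T` are only observed, the candidate of (0-based) rank `m` is selected with probability
`T / n * rankWeight N T m`. -/
noncomputable def rankWeight (N T m : ℕ) : ℝ :=
  ∑ s ∈ Finset.Ico T N, (1 / (s : ℝ)) * ((N - s).choose m / N.choose m) + 1 / N

/-- The decrement of `rankWeight N (N + 1 - K)` at `m ≥ 2`. -/
noncomputable def gap (N K m : ℕ) : ℝ := (K.choose m : ℝ) / (m * N.choose m)

theorem gap_nonneg (N K m : ℕ) : 0 ≤ gap N K m := by
  unfold gap; positivity

theorem gap_pos {N K m : ℕ} (hm : 0 < m) (hK : m ≤ K) (hN : K ≤ N) : 0 < gap N K m := by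
  have h1 := Nat.choose_pos hK
  have h2 := Nat.choose_pos (hK.trans hN)
  unfold gap; positivity

theorem gap_eq_zero {N K m : ℕ} (h : K < m) : gap N K m = 0 := by
  simp [gap, Nat.choose_eq_zero_of_lt h]

theorem cast_choose_succ_mul {K m : ℕ} (h : m ≤ K) :
    (K.choose (m + 1) : ℝ) * (m + 1) = K.choose m * (K - m) := by
  have := Nat.choose_succ_right_eq K m
  rw [← Nat.cast_sub h]
  exact_mod_cast this

theorem gap_succ {N K m : ℕ} (hm : 0 < m) (hK : m ≤ K) (hN : m < N) :
    gap N K (m + 1) = gap N K m * (m * (K - m) / ((m + 1) * (N - m))) := by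
  have h1 := cast_choose_succ_mul hK
  have h2 := cast_choose_succ_mul hN.le
  have h3 : (0 : ℝ) < N.choose m := by exact_mod_cast Nat.choose_pos hN.le
  have h4 : (0 : ℝ) < N.choose (m + 1) := by exact_mod_cast Nat.choose_pos hN
  have h5 : (0 : ℝ) < (N : ℝ) - m := sub_pos.2 (by exact_mod_cast hN)
  have h6 : (0 : ℝ) < m := by exact_mod_cast hm
  unfold gap
  push_cast
  rw [div_mul_div_comm, div_eq_div_iff (by positivity) (by positivity)]
  linear_combination ((m : ℝ) * N.choose m * (N - m)) * h1 - (m : ℝ) * (K.choose m * (K - m)) * h2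

/-- Hockey-stick identity. The sum misses the term `Nat.choose 0 m`, which is nonzero only for `m =
0`. -/
theorem sum_Ico_choose_sub {N T : ℕ} (hT : T ≤ N) (m : ℕ) :
    ∑ s ∈ Finset.Ico T N, (N - s).choose m + (if m = 0 then 1 else 0)
      = (N - T + 1).choose (m + 1) := by
  obtain ⟨d, rfl⟩ := Nat.exists_eq_add_of_le hT
  have : ∑ s ∈ Finset.Ico T (T + d), (T + d - s).choose m
      = ∑ v ∈ Finset.range d, (v + 1).choose m := by
    rw [Finset.sum_Ico_eq_sum_range, ← Finset.sum_range_reflect]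
    refine Finset.sum_congr (by simp) fun v hv => ?_
    simp only [Finset.mem_range] at hv
    congr 1
    omega
  rw [this, show T + d - T + 1 = d + 1 by omega]
  clear this hT
  induction d with
  | zero => rcases m with _ | m <;> simp [Nat.choose_eq_zero_of_lt]
  | succ d ih =>
    rw [Finset.sum_range_succ, Nat.choose_succ_succ (d + 1) m, ← ih]
    omega

/-- Termwise, the difference of the two binomial ratios carries a factor `s` that cancels `1 / s`.
The rest sums by the hockey-stick identity, whose correction at `m = 0` produces the exceptional `1
/ N`. -/
theorem rankWeight_sub_succ {N T m : ℕ} (hT₀ : 0 < T) (hT : T ≤ N) (hm : m < N) :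
    rankWeight N T m - rankWeight N T (m + 1) =
      gap N (N - T + 1) (m + 1) - if m = 0 then 1 / (N : ℝ) else 0 := by
  have h2 := cast_choose_succ_mul hm.le
  have h3 : (0 : ℝ) < N.choose m := by exact_mod_cast Nat.choose_pos hm.le
  have h4 : (0 : ℝ) < N.choose (m + 1) := by exact_mod_cast Nat.choose_pos hm
  have h5 : (0 : ℝ) < (N : ℝ) - m := sub_pos.2 (by exact_mod_cast hm)
  have key : ∀ s ∈ Finset.Ico T N,
      (1 / (s : ℝ)) * ((N - s).choose m / N.choose m) -
        (1 / (s : ℝ)) * ((N - s).choose (m + 1) / N.choose (m + 1)) =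
      ((N - s).choose m : ℝ) / ((m + 1) * N.choose (m + 1)) := by
    intro s hs
    rw [Finset.mem_Ico] at hs
    have hs0 : (0 : ℝ) < s := by exact_mod_cast hT₀.trans_le hs.1
    have h1 : (((N - s).choose (m + 1) : ℕ) : ℝ) * (m + 1) = (N - s).choose m * (N - s - m) := by
      rcases le_or_gt m (N - s) with h | h
      · have := cast_choose_succ_mul h
        rwa [Nat.cast_sub hs.2.le] at this
      · rw [Nat.choose_eq_zero_of_lt h, Nat.choose_eq_zero_of_lt (by omega)]; simp
    have e1 : ((N - s).choose (m + 1) : ℝ) = (N - s).choose m * (N - s - m) / (m + 1) := by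
      rw [eq_div_iff (by positivity)]; exact h1
    have e2 : (N.choose (m + 1) : ℝ) = N.choose m * (N - m) / (m + 1) := by
      rw [eq_div_iff (by positivity)]; exact h2
    rw [e1, e2]
    field_simp
    ring
  have hsum := sum_Ico_choose_sub hT m
  have hsum' : ∑ s ∈ Finset.Ico T N, (((N - s).choose m : ℕ) : ℝ)
      = ((N - T + 1).choose (m + 1) : ℝ) - if m = 0 then 1 else 0 := by
    rw [← hsum]; push_cast; ring
  unfold rankWeight gap
  rw [add_sub_add_right_eq_sub, ← Finset.sum_sub_distrib, Finset.sum_congr rfl key,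
    ← Finset.sum_div, hsum', sub_div]
  rcases m with _ | m <;> simp

theorem inv_le_rankWeight (N T m : ℕ) : 1 / (N : ℝ) ≤ rankWeight N T m := by
  unfold rankWeight
  exact le_add_of_nonneg_left (Finset.sum_nonneg fun s _ => by positivity)

theorem rankWeight_pos {N T : ℕ} (hN : 0 < N) (m : ℕ) : 0 < rankWeight N T m :=
  lt_of_lt_of_le (by positivity) (inv_le_rankWeight N T m)

theorem rankWeight_eq_add_gap {N T m : ℕ} (hT₀ : 0 < T) (hT : T ≤ N) (hm₀ : 0 < m) (hm : m < N) :
    rankWeight N T m = rankWeight N T (m + 1) + gap N (N - T + 1) (m + 1) := by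
  have := rankWeight_sub_succ hT₀ hT hm
  rw [if_neg hm₀.ne'] at this
  linarith

theorem rankWeight_zero_eq {N T : ℕ} (hT₀ : 0 < T) (hT : T ≤ N) :
    rankWeight N T 0 = rankWeight N T 1 + ((N : ℝ) - T) / N := by
  have := rankWeight_sub_succ hT₀ hT (hT₀.trans_le hT)
  have hN : (0 : ℝ) < N := by exact_mod_cast hT₀.trans_le hT
  simp only [gap, zero_add, Nat.choose_one_right, if_true] at this
  push_cast [hT] at this
  rw [← sub_eq_iff_eq_add', this]
  field_simp
  ring

theorem rankWeight_succ_le {N T m : ℕ} (hT₀ : 0 < T) (hT : T ≤ N) (hm : m < N) :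
    rankWeight N T (m + 1) ≤ rankWeight N T m := by
  rcases Nat.eq_zero_or_pos m with rfl | h
  · rw [rankWeight_zero_eq hT₀ hT]
    have : (T : ℝ) ≤ N := by exact_mod_cast hT
    have : (0 : ℝ) ≤ ((N : ℝ) - T) / N := div_nonneg (by linarith) (by positivity)
    simpa using this
  · rw [rankWeight_eq_add_gap hT₀ hT h hm]
    linarith [gap_nonneg N (N - T + 1) (m + 1)]

/-! ### Log-convexity of the rank weights -/

theorem choose_mul_pow_le {K N : ℕ} (h : K ≤ N) (m : ℕ) :
    K.choose m * N ^ m ≤ N.choose m * K ^ m := by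
  induction m with
  | zero => simp
  | succ m ih =>
    refine Nat.le_of_mul_le_mul_right ?_ (Nat.succ_pos m)
    have h1 := Nat.choose_succ_right_eq K m
    have h2 := Nat.choose_succ_right_eq N m
    have h3 : (K - m) * N ≤ (N - m) * K := by
      rw [Nat.sub_mul, Nat.sub_mul, mul_comm N K]
      exact Nat.sub_le_sub_left (Nat.mul_le_mul_left m h) _
    calc K.choose (m + 1) * N ^ (m + 1) * (m + 1)
        = (K.choose (m + 1) * (m + 1)) * N ^ m * N := by ring
      _ = (K.choose m * N ^ m) * ((K - m) * N) := by rw [h1]; ring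
      _ ≤ (N.choose m * K ^ m) * ((N - m) * K) := Nat.mul_le_mul ih h3
      _ = (N.choose (m + 1) * (m + 1)) * K ^ m * K := by rw [h2]; ring
      _ = N.choose (m + 1) * K ^ (m + 1) * (m + 1) := by ring

theorem one_add_pow_ge {y : ℝ} (hy : 0 ≤ y) (m : ℕ) :
    1 + (m + 1) * y + m * (m + 1) / 2 * y ^ 2 ≤ (1 + y) ^ (m + 1) := by
  induction m with
  | zero => simp
  | succ m ih =>
    have h3 : 0 ≤ (m : ℝ) * (m + 1) / 2 * y ^ 3 := by positivity
    calc 1 + (((m + 1 : ℕ) : ℝ) + 1) * y + (m + 1 : ℕ) * ((m + 1 : ℕ) + 1) / 2 * y ^ 2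
        = (1 + (m + 1) * y + m * (m + 1) / 2 * y ^ 2) * (1 + y) - m * (m + 1) / 2 * y ^ 3 := by
          push_cast; ring
      _ ≤ (1 + (m + 1) * y + m * (m + 1) / 2 * y ^ 2) * (1 + y) := sub_le_self _ h3
      _ ≤ (1 + y) ^ (m + 1) * (1 + y) := mul_le_mul_of_nonneg_right ih (by linarith)
      _ = (1 + y) ^ (m + 1 + 1) := (pow_succ _ _).symm

/-- The finitely many cases `e < 4` of `quadratic_bound`, where `j + m ≤ 2 * e + 3 ≤ 9`. -/
theorem quadratic_small_cases : ∀ e < 4, ∀ j < 10, ∀ m < 10,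
    0 < e ∧ j + m ≤ 2 * e + 3 ∧ j * (j + e) < (m + 1) ^ 2 * e + j →
    2 * m * j * (j + m + e) * (j + m) ^ 2 ≤ (m + 1) * (j + e * (m + 1)) *
      (2 * (j + m) ^ 2 + 2 * (m + 1) * e * (j + m) + m * (m + 1) * e ^ 2) := by
  decide +kernel

theorem quadratic_bound {e j m : ℕ} (he : 0 < e) (hK : j + m ≤ 2 * e + 3)
    (hv : j * (j + e) < (m + 1) ^ 2 * e + j) :
    2 * m * j * (j + m + e) * (j + m) ^ 2 ≤ (m + 1) * (j + e * (m + 1)) *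
      (2 * (j + m) ^ 2 + 2 * (m + 1) * e * (j + m) + m * (m + 1) * e ^ 2) := by
  rcases lt_or_ge e 4 with h4 | h4
  · exact quadratic_small_cases e h4 j (by omega) m (by omega) ⟨he, hK, hv⟩
  · have h1 : j * (j + m + e) ≤ (m + 1) * (j + e * (m + 1)) := by nlinarith
    have h2 : 2 * m * (j + m) ^ 2 ≤
        2 * (j + m) ^ 2 + 2 * (m + 1) * e * (j + m) + m * (m + 1) * e ^ 2 := by
      -- For `e ≥ 4`, `2 * e + 3 ≤ 11 * e / 4`. Inserting `e ≥ 4 * A / 11` leaves `16 m² - 138 m +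
      -- 330`, of negative discriminant.
      have hA : 4 * (j + m) ≤ 11 * e := by omega
      generalize j + m = A at hA
      have hA' : (4 : ℝ) * A ≤ 11 * e := by exact_mod_cast hA
      have he' : (4 / 11 : ℝ) * A ≤ e := by linarith
      have hA0 : (0 : ℝ) ≤ 4 / 11 * A := by positivity
      have h3 : (4 / 11 : ℝ) * A * A ≤ e * A := mul_le_mul_of_nonneg_right he' (by positivity)
      have h4 : ((4 / 11 : ℝ) * A) ^ 2 ≤ e ^ 2 := pow_le_pow_left₀ hA0 he' 2
      have h5 : (0 : ℝ) ≤ (16 * m ^ 2 - 138 * m + 330) / 121 * A ^ 2 := by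
        refine mul_nonneg (div_nonneg ?_ (by norm_num)) (by positivity)
        nlinarith [sq_nonneg (4 * (m : ℝ) - 69 / 4)]
      have h6 := mul_le_mul_of_nonneg_left h3 (by positivity : (0 : ℝ) ≤ 2 * (m + 1))
      have h7 := mul_le_mul_of_nonneg_left h4 (by positivity : (0 : ℝ) ≤ m * (m + 1))
      have : (2 * m * A ^ 2 : ℝ) ≤
          2 * A ^ 2 + 2 * (m + 1) * e * A + m * (m + 1) * e ^ 2 := by linarith
      exact_mod_cast this
    calc 2 * m * j * (j + m + e) * (j + m) ^ 2
        = (j * (j + m + e)) * (2 * m * (j + m) ^ 2) := by ring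
      _ ≤ _ := Nat.mul_le_mul h1 h2

/-- The hypothesis `y ^ 2 ≤ x * z` says `y / x ≤ z / y`, whence `y² / (x - y) ≤ y z / (y - z) ≤ b`.
This is the descent step, with `x, y, z` consecutive decrements and `b + y` the preceding weight. -/
theorem mul_le_add_mul_sub {x y z b : ℝ} (hz : 0 ≤ z) (hzy : z < y) (hyx : y ≤ x)
    (h : y * z ≤ b * (y - z)) (h' : y ^ 2 ≤ x * z) : x * y ≤ (b + y) * (x - y) := by
  have h1 : y ^ 2 ≤ b * (x - y) := by
    refine le_of_mul_le_mul_right ?_ (sub_pos.2 hzy)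
    have h2 := mul_le_mul_of_nonneg_right h (sub_nonneg.2 hyx)
    have h3 := mul_le_mul_of_nonneg_left h' (hz.trans hzy.le)
    nlinarith
  nlinarith

theorem gap_succ_lt {N K m : ℕ} (hm : 0 < m) (hK : m ≤ K) (hKN : K < N) :
    gap N K (m + 1) < gap N K m := by
  have hN : m < N := hK.trans_lt hKN
  rw [gap_succ hm hK hN]
  refine mul_lt_of_lt_one_right (gap_pos hm hK hKN.le) ?_
  have h1 : (m : ℝ) ≤ K := by exact_mod_cast hK
  have h2 : (K : ℝ) < N := by exact_mod_cast hKN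
  have h3 : (0 : ℝ) < m := by exact_mod_cast hm
  rw [div_lt_one (by apply mul_pos <;> linarith)]
  nlinarith

/-- While `m` is small compared to `√N`, the sequence `gap N K` is log-convex at `m + 1`. -/
theorem gap_sq_le {N K m : ℕ} (hm : 0 < m) (hK : m < K) (hKN : K < N)
    (h : (m + 1) ^ 2 * (N - K) + (K - m) ≤ (K - m) * (N - m)) :
    gap N K (m + 1) ^ 2 ≤ gap N K m * gap N K (m + 2) := by
  obtain ⟨j, rfl⟩ := Nat.exists_eq_add_of_lt hK
  obtain ⟨e, rfl⟩ := Nat.exists_eq_add_of_lt hKN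
  have e1 := gap_succ (N := m + j + 1 + e + 1) hm hK.le (by omega)
  have e2 := gap_succ (N := m + j + 1 + e + 1) (K := m + j + 1) (m := m + 1) (by omega) (by omega)
    (by omega)
  rw [show m + 1 + 1 = m + 2 by ring] at e2
  rw [e2, sq]
  have h0 := gap_nonneg (m + j + 1 + e + 1) (m + j + 1) (m + 1)
  have h00 := gap_nonneg (m + j + 1 + e + 1) (m + j + 1) m
  rw [mul_left_comm]
  refine mul_le_mul_of_nonneg_left ?_ h0
  rw [e1]
  refine mul_le_mul_of_nonneg_left ?_ h00
  rw [show m + j + 1 + e + 1 - (m + j + 1) = e + 1 by omega, show m + j + 1 - m = j + 1 by omega,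
    show m + j + 1 + e + 1 - m = j + 1 + e + 1 by omega] at h
  have h' : ((m : ℝ) + 1) ^ 2 * (e + 1) + (j + 1) ≤ (j + 1) * (j + 1 + e + 1) := by
    exact_mod_cast h
  push_cast
  rw [show (m : ℝ) + j + 1 - m = j + 1 by ring, show (m : ℝ) + j + 1 + e + 1 - m = j + e + 2 by ring,
    show (m : ℝ) + j + 1 - (m + 1) = j by ring,
    show (m : ℝ) + j + 1 + e + 1 - (m + 1) = j + e + 1 by ring,
    div_le_div_iff₀ (by positivity) (by positivity)]
  have hm1 : (0 : ℝ) ≤ m + 1 := by positivity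
  -- With denominators cleared, the comparison of consecutive ratios of `gap` is equivalent to `h`.
  nlinarith [mul_le_mul_of_nonneg_left h' hm1]

/-- Past the range of `gap_sq_le`, the gaps are small compared to `1 / N`. -/
theorem mul_gap_sq_le {N K m : ℕ} (hm : 0 < m) (hK : m < K) (hKN : K < N)
    (hlin : K ≤ 2 * (N - K) + 3)
    (h : (K - m) * (N - m) < (m + 1) ^ 2 * (N - K) + (K - m)) :
    N * gap N K (m + 1) ^ 2 ≤ gap N K m - gap N K (m + 1) := by
  obtain ⟨j, rfl⟩ := Nat.exists_eq_add_of_le hK.le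
  obtain ⟨e, rfl⟩ := Nat.exists_eq_add_of_le hKN.le
  have hj : 0 < j := by omega
  have he : 0 < e := by omega
  rw [show m + j + e - (m + j) = e by omega] at hlin h
  rw [show m + j - m = j by omega, show m + j + e - m = j + e by omega] at h
  have hq := quadratic_bound he (by omega) h
  have hstep := gap_succ (N := m + j + e) hm hK.le (by omega)
  have hM : 0 < gap (m + j + e) (m + j) (m + 1) := gap_pos (by omega) (by omega) hKN.le
  set d := gap (m + j + e) (m + j) (m + 1) with hd
  have hmR : (0 : ℝ) < m := by exact_mod_cast hm
  have hjR : (0 : ℝ) < j := by exact_mod_cast hj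
  have heR : (0 : ℝ) < e := by exact_mod_cast he
  have hprev : gap (m + j + e) (m + j) m = d * ((m + 1) * (j + e) / (m * j)) := by
    rw [hstep]
    push_cast
    rw [show (m : ℝ) + j - m = j by ring, show (m : ℝ) + j + e - m = j + e by ring]
    field_simp
  rw [hprev]
  suffices H : ((m + j + e : ℕ) : ℝ) * d ≤ (m + 1) * (j + e) / (m * j) - 1 by
    have := mul_le_mul_of_nonneg_left H hM.le
    linarith
  have hy := one_add_pow_ge (y := (e : ℝ) / (m + j)) (by positivity) m
  have hpow : ((m + j : ℕ).choose (m + 1) : ℝ) * (m + j + e) ^ (m + 1) ≤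
      (m + j + e).choose (m + 1) * (m + j) ^ (m + 1) := by
    exact_mod_cast choose_mul_pow_le hKN.le (m + 1)
  have hc : (0 : ℝ) < (m + j + e).choose (m + 1) := by
    exact_mod_cast Nat.choose_pos (by omega)
  -- `(m + 1) * d` is a quotient of binomials, at most `(K / N) ^ (m + 1)`. Only the second-order
  -- truncation `Q` of the reciprocal power is kept, which turns `H` into `quadratic_bound`.
  have hdle : d * (m + 1) * (1 + (e : ℝ) / (m + j)) ^ (m + 1) ≤ 1 := by
    rw [hd, gap, show 1 + (e : ℝ) / (m + j) = (m + j + e) / (m + j) by field_simp, div_pow]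
    push_cast
    rw [div_mul_eq_mul_div, div_mul_div_comm, div_le_one (by positivity)]
    have : (0 : ℝ) ≤ m + 1 := by positivity
    nlinarith [mul_le_mul_of_nonneg_left hpow this]
  have hqR : (2 * m * j * (j + m + e) * (j + m) ^ 2 : ℝ) ≤ (m + 1) * (j + e * (m + 1)) *
      (2 * (j + m) ^ 2 + 2 * (m + 1) * e * (j + m) + m * (m + 1) * e ^ 2) := by
    exact_mod_cast hq
  set Q : ℝ := 1 + (m + 1) * (e / (m + j)) + m * (m + 1) / 2 * (e / (m + j)) ^ 2 with hQ
  have hQpos : 0 < Q := by positivity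
  have hQeq : 2 * (j + m) ^ 2 * Q =
      2 * (j + m) ^ 2 + 2 * (m + 1) * e * (j + m) + m * (m + 1) * e ^ 2 := by
    rw [hQ]; field_simp; ring
  have h1 : d * (m + 1) * Q ≤ 1 :=
    (mul_le_mul_of_nonneg_left hy (by positivity)).trans hdle
  have h2 : (m * j * (j + m + e) : ℝ) ≤ (m + 1) * (j + e * (m + 1)) * Q := by
    rw [← hQeq] at hqR
    refine le_of_mul_le_mul_right ?_ (by positivity : (0 : ℝ) < 2 * (j + m) ^ 2)
    linarith
  rw [show ((m : ℝ) + 1) * (j + e) / (m * j) - 1 = (j + e * (m + 1)) / (m * j) by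
    field_simp; ring, le_div_iff₀ (by positivity)]
  push_cast
  calc ((m : ℝ) + j + e) * d * (m * j) = d * (m * j * (j + m + e)) := by ring
    _ ≤ d * ((m + 1) * (j + e * (m + 1)) * Q) := mul_le_mul_of_nonneg_left h2 hM.le
    _ = (d * (m + 1) * Q) * (j + e * (m + 1)) := by ring
    _ ≤ 1 * (j + e * (m + 1)) := mul_le_mul_of_nonneg_right h1 (by positivity)
    _ = _ := one_mul _

theorem gap_mul_gap_le {N T : ℕ} (hT : 2 ≤ T) (hTN : T ≤ N) (hlin : N ≤ 3 * T) {k : ℕ}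
    (hk : 0 < k) :
    gap N (N - T + 1) k * gap N (N - T + 1) (k + 1) ≤
      rankWeight N T k * (gap N (N - T + 1) k - gap N (N - T + 1) (k + 1)) := by
  set K := N - T + 1 with hKdef
  have hKN : K < N := by omega
  rcases le_or_gt K k with hKk | hKk
  · rw [gap_eq_zero (show K < k + 1 by omega), mul_zero, sub_zero]
    exact mul_nonneg (rankWeight_pos (by omega) k).le (gap_nonneg _ _ _)
  induction hd : K - k generalizing k with
  | zero => omega
  | succ d ih =>
    have hb := rankWeight_eq_add_gap (by omega) hTN hk (hKk.trans hKN)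
    rw [← hKdef] at hb
    have hlt := gap_succ_lt hk hKk.le hKN
    rcases le_or_gt ((k + 1) ^ 2 * (N - K) + (K - k)) ((K - k) * (N - k)) with h | h
    · have hk1 : k + 1 < K := by
        by_contra hcon
        rw [show K - k = 1 by omega, show N - k = N - K + 1 by omega] at h
        nlinarith [Nat.sub_pos_of_lt hKN, Nat.pow_le_pow_left (show 2 ≤ k + 1 by omega) 2]
      rw [hb]
      exact mul_le_add_mul_sub (gap_nonneg _ _ _) (gap_succ_lt (by omega) hk1.le hKN) hlt.le
        (ih (by omega) hk1 (by omega)) (gap_sq_le hk hKk hKN h)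
    · have h1 := mul_gap_sq_le hk hKk hKN (by omega) h
      have h2 := inv_le_rankWeight N T (k + 1)
      have hN : (0 : ℝ) < N := by exact_mod_cast (by omega : 0 < N)
      set x := gap N K k
      set y := gap N K (k + 1)
      have h3 : y ^ 2 ≤ 1 / N * (x - y) := by
        rw [one_div_mul_eq_div, le_div_iff₀ hN]; linarith
      have h4 := mul_le_mul_of_nonneg_right h2 (sub_pos.2 hlt).le
      rw [hb]
      nlinarith

/-- Serves the second case of `rankWeight_one_sq_le`. The bound `6 ≤ N` matters: `N = 5`, `T = 2`,
`K = 4` violates the conclusion. -/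
theorem eight_mul_le_of_lt {N T K : ℕ} (hT : 2 ≤ T) (hNK : N + 1 = K + T) (hlin : N ≤ 3 * T)
    (hN : 6 ≤ N) (h : T * (N + T - 3) < K * (K - 1)) : 8 * N ≤ K * N + 2 * K + 8 := by
  rcases le_or_gt 8 K with h8 | h8
  · nlinarith
  · obtain rfl : N = K + T - 1 := by omega
    have hT6 : T < 8 := by
      by_contra hcon
      have h1 : K * (K - 1) ≤ 7 * 6 := Nat.mul_le_mul (by omega) (by omega)
      have h2 : 8 * 11 ≤ T * (K + T - 1 + T - 3) := Nat.mul_le_mul (by omega) (by omega)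
      omega
    interval_cases K <;> interval_cases T <;> omega

theorem rankWeight_one_sq_le {N T : ℕ} (hT : 2 ≤ T) (hTN : T ≤ N) (hlin : N ≤ 3 * T) (hN : 6 ≤ N)
    (h0 : 1 < rankWeight N T 0) (hK2 : T + 2 ≤ N):
    rankWeight N T 1 ^ 2 ≤ rankWeight N T 0 * rankWeight N T 2 := by
  set K := N - T + 1 with hKdef
  have hKN : K < N := by omega
  have hb0 := rankWeight_zero_eq (by omega) hTN
  have hb1 := rankWeight_eq_add_gap (by omega) hTN one_pos (by omega)
  have hb2 := rankWeight_eq_add_gap (by omega) hTN two_pos (by omega)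
  rw [← hKdef] at hb1 hb2
  simp only [Nat.reduceAdd] at hb1 hb2
  set x : ℝ := ((N : ℝ) - T) / N with hx
  have hKR : (K : ℝ) = N - T + 1 := by rw [hKdef]; push_cast [hTN]; ring
  have hTR : (2 : ℝ) ≤ T := by exact_mod_cast hT
  have hNR : (6 : ℝ) ≤ N := by exact_mod_cast hN
  have hTNR : (T : ℝ) + 2 ≤ N := by exact_mod_cast hK2
  have hy : gap N K 2 = x * (K / (2 * (N - 1))) := by
    have := gap_succ (N := N) (K := K) one_pos (by omega) (by omega)
    rw [this, gap, hx]
    push_cast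
    rw [Nat.choose_one_right, Nat.choose_one_right, hKR]
    field_simp
    ring
  have hz : gap N K 3 = gap N K 2 * (2 * (K - 2) / (3 * (N - 2))) := by
    have := gap_succ (N := N) (K := K) two_pos (by omega) (by omega)
    rw [this]
    norm_num
  have hxpos : 0 < x := div_pos (by linarith) (by linarith)
  have hKle : (K : ℝ) / (2 * (N - 1)) ≤ 1 := by
    rw [div_le_one (by linarith), hKR]; linarith
  have hyx : gap N K 2 ≤ x := by rw [hy]; exact mul_le_of_le_one_right hxpos.le hKle
  suffices H : x * gap N K 2 ≤ rankWeight N T 1 * (x - gap N K 2) by nlinarith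
  -- Since `b 0 > 1`, `b 1 ≥ 1 - x = T / N`; the first alternative is equivalent to `H` with `b 1`
  -- replaced by `T / N`. Otherwise `x`, `gap N K 2`, `gap N K 3` are log-convex and the descent
  -- step applies.
  rcases le_or_gt (K * (K - 1)) (T * (N + T - 3)) with h | h
  · have h' : (K : ℝ) * (K - 1) ≤ T * (N + T - 3) := by
      have e1 : ((K - 1 : ℕ) : ℝ) = K - 1 := by push_cast [show 1 ≤ K by omega]; ring
      have e2 : ((N + T - 3 : ℕ) : ℝ) = N + T - 3 := by push_cast [show 3 ≤ N + T by omega]; ring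
      rw [← e1, ← e2]
      exact_mod_cast h
    have h1 : (T : ℝ) / N ≤ rankWeight N T 1 := by
      have : x = 1 - T / N := by rw [hx]; field_simp
      linarith
    refine le_trans ?_ (mul_le_mul_of_nonneg_right h1 (sub_nonneg.2 hyx))
    rw [hy, show T / N * (x - x * (K / (2 * (N - 1)))) = x * (T / N * (1 - K / (2 * (N - 1)))) by ring]
    refine mul_le_mul_of_nonneg_left ?_ hxpos.le
    have hN1 : (0 : ℝ) < N - 1 := by linarith
    rw [hx, div_mul_div_comm, one_sub_div (by positivity), div_mul_div_comm]
    refine div_le_div_of_nonneg_right ?_ (by positivity)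
    rw [hKR] at h' ⊢
    linarith
  · have hlarge := eight_mul_le_of_lt hT (by omega) hlin hN h
    have h' : (8 * N : ℝ) ≤ K * N + 2 * K + 8 := by exact_mod_cast hlarge
    have hN1 : (0 : ℝ) < N - 1 := by linarith
    have hN2 : (0 : ℝ) < N - 2 := by linarith
    rw [hb1]
    refine mul_le_add_mul_sub (gap_nonneg _ _ _) (gap_succ_lt two_pos (by omega) hKN) hyx
      (gap_mul_gap_le hT hTN hlin two_pos) ?_
    rw [hz, sq, mul_left_comm]
    refine mul_le_mul_of_nonneg_left ?_ (gap_nonneg _ _ _)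
    rw [hy]
    refine mul_le_mul_of_nonneg_left ?_ hxpos.le
    rw [div_le_div_iff₀ (by positivity) (by positivity)]
    nlinarith

theorem rankWeight_sq_le {N T : ℕ} (hT : 2 ≤ T) (hlin : N ≤ 3 * T) (hN : 6 ≤ N)
    (h0 : 1 < rankWeight N T 0) (hTN : T + 2 ≤ N) {k : ℕ} (hk : k + 2 ≤ N) :
    rankWeight N T (k + 1) ^ 2 ≤ rankWeight N T k * rankWeight N T (k + 2) := by
  rcases Nat.eq_zero_or_pos k with rfl | hk0
  · exact rankWeight_one_sq_le hT (by omega) hlin hN h0 hTN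
  · have h1 := rankWeight_eq_add_gap (N := N) (T := T) (by omega) (by omega) hk0 (by omega)
    have h2 := rankWeight_eq_add_gap (N := N) (T := T) (m := k + 1) (by omega) (by omega) (by omega)
      (by omega)
    have h3 := gap_mul_gap_le hT (by omega) hlin (k := k + 1) (by omega)
    rw [show k + 1 + 1 = k + 2 by ring] at h2 h3
    rw [h1, eq_sub_of_add_eq h2.symm]
    linarith

/-- Log-convexity makes the ratios `b (i + 1) / b i` nondecreasing, so `b l / b 0 ≤ b (m + l) / b
m`. -/
theorem mul_le_mul_of_log_convex {b : ℕ → ℝ} {N : ℕ} (hpos : ∀ k, 0 < b k)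
    (h : ∀ k, k + 2 ≤ N → b (k + 1) ^ 2 ≤ b k * b (k + 2)) {m l : ℕ} (hml : m + l ≤ N) :
    b m * b l ≤ b 0 * b (m + l) := by
  have ratio : ∀ i d, i + d + 1 ≤ N → b (i + 1) / b i ≤ b (i + d + 1) / b (i + d) := by
    intro i d
    induction d with
    | zero => intro _; rfl
    | succ d ih =>
      intro hd
      refine (ih (by omega)).trans ?_
      rw [div_le_div_iff₀ (hpos _) (hpos _)]
      have := h (i + d) (by omega)
      rw [show i + (d + 1) + 1 = i + d + 2 by ring, show i + (d + 1) = i + d + 1 by ring]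
      linarith
  induction l with
  | zero => simp [mul_comm]
  | succ l ih =>
    have h1 := ratio l m (by omega)
    rw [show l + m + 1 = m + (l + 1) by ring, add_comm l m] at h1
    have h2 := mul_le_mul (ih (by omega)) h1 (div_pos (hpos _) (hpos _)).le
      (mul_pos (hpos _) (hpos _)).le
    have e1 : b m * b l * (b (l + 1) / b l) = b m * b (l + 1) := by
      field_simp [(hpos l).ne']
    have e2 : b 0 * b (m + l) * (b (m + (l + 1)) / b (m + l)) = b 0 * b (m + (l + 1)) := by
      field_simp [(hpos (m + l)).ne']
    rwa [e1, e2] at h2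

/-! ### Size of the threshold -/

/-- Passing from `T` to `T + 1` drops `1 / (T + 1)` and adds three reciprocals whose sum is at least
`3 / (3 T + 3)` by convexity. This yields `N ≤ 3 * observed N`. -/
theorem one_lt_sum_Ico {T : ℕ} (hT : 1 ≤ T) :
    1 < ∑ i ∈ Finset.Ico (T + 1) (3 * T + 2), (1 : ℝ) / i := by
  induction T, hT using Nat.le_induction with
  | base => norm_num [Finset.sum_Ico_succ_top]
  | succ T hT ih =>
    have h1 := Finset.sum_eq_sum_Ico_succ_bot (show T + 1 < 3 * T + 5 by omega)
      (fun i : ℕ => (1 : ℝ) / i)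
    rw [Finset.sum_Ico_succ_top (show T + 1 ≤ 3 * T + 4 by omega),
      Finset.sum_Ico_succ_top (show T + 1 ≤ 3 * T + 3 by omega),
      Finset.sum_Ico_succ_top (show T + 1 ≤ 3 * T + 2 by omega)] at h1
    rw [show 3 * (T + 1) + 2 = 3 * T + 5 by ring]
    have h2 : (1 : ℝ) / (T + 1 : ℕ) ≤
        1 / (3 * T + 2 : ℕ) + 1 / (3 * T + 3 : ℕ) + 1 / (3 * T + 4 : ℕ) := by
      push_cast
      rw [div_add_div _ _ (by positivity) (by positivity),
        div_add_div _ _ (by positivity) (by positivity),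
        div_le_div_iff₀ (by positivity) (by positivity)]
      have : (0 : ℝ) ≤ T := by positivity
      nlinarith
    linarith

theorem threshold_spec (N : ℕ) : 1 ≤ threshold (N + 1) ∧
    ∑ i ∈ Finset.Ico (threshold (N + 1)) (N + 1), (1 : ℝ) / i ≤ 1 :=
  Nat.sInf_mem (s := {t : ℕ | 1 ≤ t ∧ ∑ i ∈ Finset.Ico t (N + 1), (1 : ℝ) / i ≤ 1})
    ⟨N + 1, by simp⟩

theorem threshold_le (N : ℕ) : threshold (N + 1) ≤ N + 1 := by
  apply Nat.sInf_le
  simp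

theorem one_lt_sum_of_lt_threshold {N t : ℕ} (ht : 1 ≤ t) (h : t < threshold (N + 1)) :
    1 < ∑ i ∈ Finset.Ico t (N + 1), (1 : ℝ) / i := by
  by_contra! hcon
  exact Nat.notMem_of_lt_sInf h ⟨ht, hcon⟩

theorem rankWeight_zero {N T : ℕ} (hT : T ≤ N) :
    rankWeight N T 0 = ∑ i ∈ Finset.Ico T (N + 1), (1 : ℝ) / i := by
  simp [rankWeight, Finset.sum_Ico_succ_top hT]

/-- The number of candidates that are only observed: the threshold counts times from `1`. -/
noncomputable def observed (N : ℕ) : ℕ := threshold (N + 1) - 1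

theorem observed_add_one (N : ℕ) : observed N + 1 = threshold (N + 1) := by
  have := (threshold_spec N).1
  unfold observed
  omega

theorem observed_le (N : ℕ) : observed N ≤ N := by
  have := threshold_le N
  unfold observed
  omega

theorem sum_observed_succ_le (N : ℕ) :
    ∑ i ∈ Finset.Ico (observed N + 1) (N + 1), (1 : ℝ) / i ≤ 1 := by
  rw [observed_add_one]
  exact (threshold_spec N).2

theorem observed_pos {N : ℕ} (hN : 2 ≤ N) : 1 ≤ observed N := by
  by_contra! hcon
  have h := sum_observed_succ_le N
  have h2 : ∑ i ∈ Finset.Ico (1 : ℕ) 3, (1 : ℝ) / i ≤ ∑ i ∈ Finset.Ico 1 (N + 1), (1 : ℝ) / i :=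
    Finset.sum_le_sum_of_subset_of_nonneg (Finset.Ico_subset_Ico_right (by omega))
      fun _ _ _ => by positivity
  rw [show observed N = 0 by omega] at h
  norm_num [Finset.sum_Ico_succ_top] at h h2
  linarith

theorem le_three_mul_observed {N : ℕ} (hN : 2 ≤ N) : N ≤ 3 * observed N := by
  by_contra! hcon
  have h1 := one_lt_sum_Ico (observed_pos hN)
  have h2 : ∑ i ∈ Finset.Ico (observed N + 1) (3 * observed N + 2), (1 : ℝ) / i ≤
      ∑ i ∈ Finset.Ico (observed N + 1) (N + 1), (1 : ℝ) / i :=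
    Finset.sum_le_sum_of_subset_of_nonneg (Finset.Ico_subset_Ico_right (by omega))
      fun _ _ _ => by positivity
  linarith [sum_observed_succ_le N]

theorem one_lt_rankWeight_zero {N : ℕ} (hN : 2 ≤ N) : 1 < rankWeight N (observed N) 0 := by
  rw [rankWeight_zero (observed_le N)]
  refine one_lt_sum_of_lt_threshold (observed_pos hN) ?_
  rw [← observed_add_one]
  omega

theorem two_mul_observed_le {N : ℕ} (hN : 2 ≤ N) : 2 * observed N ≤ N := by
  have h1 := one_lt_rankWeight_zero hN
  have hT : (0 : ℝ) < observed N := by exact_mod_cast observed_pos hN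
  rw [rankWeight_zero (observed_le N)] at h1
  have h2 : ∑ i ∈ Finset.Ico (observed N) (N + 1), (1 : ℝ) / i ≤
      ∑ i ∈ Finset.Ico (observed N) (N + 1), (1 : ℝ) / observed N := by
    refine Finset.sum_le_sum fun i hi => ?_
    rw [Finset.mem_Ico] at hi
    exact one_div_le_one_div_of_le hT (by exact_mod_cast hi.1)
  rw [Finset.sum_const, Nat.card_Ico, nsmul_eq_mul, mul_one_div] at h2
  have h3 := h1.trans_le h2
  rw [one_lt_div hT] at h3
  have : observed N < N + 1 - observed N := by exact_mod_cast h3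
  omega

/-! ### Asymptotics of the rank weights -/

theorem tendsto_observed : Tendsto observed atTop atTop := by
  refine tendsto_atTop.2 fun b => ?_
  filter_upwards [eventually_ge_atTop (3 * b + 2)] with N hN
  have := le_three_mul_observed (N := N) (by omega)
  omega

theorem cast_harmonic (n : ℕ) :
    ((harmonic n : ℚ) : ℝ) = ∑ i ∈ Finset.Ico 1 (n + 1), (1 : ℝ) / i := by
  rw [harmonic_eq_sum_Icc]
  push_cast
  simp only [one_div]
  rfl

theorem sum_Ico_eq_harmonic_sub {T N : ℕ} (h : T ≤ N) :
    ∑ i ∈ Finset.Ico (T + 1) (N + 1), (1 : ℝ) / i = (harmonic N : ℚ) - (harmonic T : ℚ) := by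
  rw [cast_harmonic, cast_harmonic, eq_sub_iff_add_eq', Finset.sum_Ico_consecutive] <;> omega

theorem tendsto_sum_observed_succ :
    Tendsto (fun N => ∑ i ∈ Finset.Ico (observed N + 1) (N + 1), (1 : ℝ) / i) atTop (𝓝 1) := by
  have h0 : Tendsto (fun N => 1 - 1 / (observed N : ℝ)) atTop (𝓝 1) := by
    simpa using tendsto_const_nhds.sub
      ((tendsto_one_div_atTop_nhds_zero_nat (𝕜 := ℝ)).comp tendsto_observed)
  refine tendsto_of_tendsto_of_tendsto_of_le_of_le' h0 tendsto_const_nhds ?_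
    (Eventually.of_forall sum_observed_succ_le)
  filter_upwards [eventually_ge_atTop 2] with N hN
  have h1 := one_lt_rankWeight_zero hN
  rw [rankWeight_zero (observed_le N),
    Finset.sum_eq_sum_Ico_succ_bot (by have := observed_le N; omega)] at h1
  linarith

theorem tendsto_rankWeight_zero :
    Tendsto (fun N => rankWeight N (observed N) 0) atTop (𝓝 1) := by
  have h0 : Tendsto (fun N => 1 / (observed N : ℝ)) atTop (𝓝 0) :=
    (tendsto_one_div_atTop_nhds_zero_nat (𝕜 := ℝ)).comp tendsto_observed
  have := h0.add tendsto_sum_observed_succ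
  rw [zero_add] at this
  refine this.congr fun N => ?_
  rw [rankWeight_zero (observed_le N)]
  exact (Finset.sum_eq_sum_Ico_succ_bot (Nat.lt_succ_of_le (observed_le N))
    fun i : ℕ => (1 : ℝ) / i).symm

/-- `H_N - H_T → 1` and `H_n - log n` converges, so `log (T / N) → -1`. -/
theorem tendsto_observed_div :
    Tendsto (fun N : ℕ => (observed N : ℝ) / N) atTop (𝓝 (1 / Real.exp 1)) := by
  have h1 := Real.tendsto_harmonic_sub_log
  have h2 := (h1.sub (h1.comp tendsto_observed)).sub tendsto_sum_observed_succ
  rw [sub_self, zero_sub] at h2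
  have h3 := (Real.continuous_exp.tendsto _).comp h2
  rw [Real.exp_neg, ← one_div] at h3
  refine h3.congr' ?_
  filter_upwards [eventually_ge_atTop 2] with N hN
  have hT : (0 : ℝ) < observed N := by exact_mod_cast observed_pos hN
  have hN' : (0 : ℝ) < N := by exact_mod_cast (by omega : 0 < N)
  simp only [Function.comp]
  rw [sum_Ico_eq_harmonic_sub (observed_le N), show ∀ a b c d : ℝ,
    a - b - (c - d) - (a - c) = d - b by intros; ring, Real.exp_sub, Real.exp_log hT,
    Real.exp_log hN']

theorem tendsto_gap (m : ℕ) :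
    Tendsto (fun N => gap N (N - observed N + 1) (m + 1)) atTop
      (𝓝 ((1 - 1 / Real.exp 1) ^ (m + 1) / (m + 1))) := by
  have hx (c d : ℝ) : Tendsto (fun N : ℕ => ((N : ℝ) - observed N + c) / (N - d)) atTop
      (𝓝 (1 - 1 / Real.exp 1)) := by
    have hinv := tendsto_one_div_atTop_nhds_zero_nat (𝕜 := ℝ)
    have h1 := ((tendsto_const_nhds (x := (1 : ℝ))).sub tendsto_observed_div).add
      (hinv.const_mul c)
    have h2 := (tendsto_const_nhds (x := (1 : ℝ))).sub (hinv.const_mul d)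
    have h3 := h1.div h2 (by norm_num)
    simp only [mul_zero, sub_zero, add_zero, div_one] at h3
    refine h3.congr' ?_
    filter_upwards [eventually_ge_atTop 1] with N hN
    have hN' : (0 : ℝ) < N := by exact_mod_cast hN
    simp only [Pi.div_apply]
    rw [show 1 - (observed N : ℝ) / N + c * (1 / N) = (N - observed N + c) / N by field_simp,
      show 1 - d * (1 / (N : ℝ)) = (N - d) / N by field_simp,
      div_div_div_cancel_right₀ hN'.ne']
  induction m with
  | zero =>
    simp only [gap, zero_add, Nat.choose_one_right, Nat.cast_one, one_mul, pow_one,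
      Nat.cast_zero, div_one]
    refine (hx 1 0).congr fun N => ?_
    push_cast [observed_le N]
    rw [sub_zero]
  | succ m ih =>
    have h := ih.mul ((hx (1 - (m + 1)) (m + 1)).const_mul (((m : ℝ) + 1) / (m + 1 + 1)))
    refine Tendsto.congr' ?_ (h.trans_eq ?_)
    · filter_upwards [eventually_ge_atTop (2 * m + 4)] with N hN
      have h2 := two_mul_observed_le (N := N) (by omega)
      rw [gap_succ (m := m + 1) (by omega) (by omega) (by omega), mul_div_mul_comm]
      push_cast [observed_le N]
      rw [add_sub_assoc]
    · congr 1
      generalize 1 - 1 / Real.exp 1 = x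
      push_cast
      rw [pow_succ _ (m + 1)]
      field_simp

theorem a_eq_add (m : ℕ) : a (m + 1) = (1 - 1 / Real.exp 1) ^ (m + 1) / (m + 1) + a (m + 2) := by
  unfold a
  rw [(summable_a (m + 1)).tsum_eq_zero_add]
  congr 1
  · push_cast; rw [add_zero, one_div_mul_eq_div, add_zero]
  · refine tsum_congr fun s => ?_
    rw [show m + 1 + (s + 1) = m + 2 + s by ring]

/-- The series of `-log (1 - x)` at `x = 1 - 1/e`. -/
theorem a_one : a 1 = 1 := by
  have he : 1 < Real.exp 1 := Real.one_lt_exp_iff.2 one_pos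
  have h1 : 0 < 1 / Real.exp 1 := by positivity
  have h2 : 1 / Real.exp 1 < 1 := by rw [div_lt_one (by positivity)]; exact he
  have h := Real.hasSum_pow_div_log_of_abs_lt_one (x := 1 - 1 / Real.exp 1)
    (by rw [abs_lt]; constructor <;> linarith)
  rw [sub_sub_cancel, one_div, Real.log_inv, Real.log_exp, neg_neg] at h
  rw [← h.tsum_eq, a]
  refine tsum_congr fun s => ?_
  push_cast
  rw [one_div_mul_eq_div, one_div, add_comm 1 s, add_comm (1 : ℝ)]

theorem tendsto_rankWeight (m : ℕ) :
    Tendsto (fun N => rankWeight N (observed N) m) atTop (𝓝 (a (m + 1))) := by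
  induction m with
  | zero => rw [zero_add, a_one]; exact tendsto_rankWeight_zero
  | succ m ih =>
    have hc : Tendsto (fun N : ℕ => if m = 0 then 1 / (N : ℝ) else 0) atTop (𝓝 0) := by
      split_ifs
      · exact tendsto_one_div_atTop_nhds_zero_nat
      · exact tendsto_const_nhds
    have h := (ih.sub (tendsto_gap m)).add hc
    rw [a_eq_add, add_zero, add_sub_cancel_left] at h
    refine h.congr' ?_
    filter_upwards [eventually_ge_atTop (m + 2)] with N hN
    have := rankWeight_sub_succ (observed_pos (by omega)) (observed_le N) (show m < N by omega)
    linarith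

theorem tendsto_selection (m : ℕ) :
    Tendsto (fun N : ℕ => (observed N : ℝ) / (N + 1) * rankWeight N (observed N) m) atTop
      (𝓝 (1 / Real.exp 1 * a (m + 1))) := by
  refine Tendsto.mul ?_ (tendsto_rankWeight m)
  have h := tendsto_observed_div.mul (tendsto_natCast_div_add_atTop (1 : ℝ))
  rw [mul_one] at h
  refine h.congr' ?_
  filter_upwards [eventually_ge_atTop 1] with N hN
  have hN' : (0 : ℝ) < N := by exact_mod_cast hN
  field_simp

/-! ### Counting permutations -/

open Classical in
/-- The number of permutations with a given property. -/
noncomputable def permCount {n : ℕ} (p : Equiv.Perm (Fin n) → Prop) : ℕ :=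
  (Finset.univ.filter p).card

section permCount

open Classical

variable {n : ℕ}

theorem permCount_congr {p q : Equiv.Perm (Fin n) → Prop} (h : ∀ π, p π ↔ q π) :
    permCount p = permCount q := by
  rw [show p = q from funext fun π => propext (h π)]

theorem permCount_comp (e : Equiv.Perm (Fin n) ≃ Equiv.Perm (Fin n))
    (p : Equiv.Perm (Fin n) → Prop) : permCount (fun π => p (e π)) = permCount p :=
  Finset.card_equiv e (by simp)

theorem permCount_eq_zero {p : Equiv.Perm (Fin n) → Prop} (h : ∀ π, ¬ p π) : permCount p = 0 := by
  simp [permCount, h]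

theorem permCount_true : permCount (fun _ : Equiv.Perm (Fin n) => True) = n.factorial := by
  simp [permCount, Finset.card_univ, Fintype.card_perm]

/-- Double counting of the pairs `(i, π)` with `p i π`. -/
theorem sum_permCount {ι : Type*} {I : Finset ι} {p : ι → Equiv.Perm (Fin n) → Prop}
    {q : Equiv.Perm (Fin n) → Prop} {c : ℕ} (hpq : ∀ i ∈ I, ∀ π, p i π → q π)
    (hq : ∀ π, q π → (I.filter fun i => p i π).card = c) :
    ∑ i ∈ I, permCount (p i) = c * permCount q := by
  unfold permCount
  simp only [Finset.card_filter]
  rw [Finset.sum_comm, Finset.mul_sum]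
  refine Finset.sum_congr rfl fun π _ => ?_
  rw [← Finset.card_filter]
  split_ifs with h
  · rw [hq π h, mul_one]
  · rw [mul_zero, Finset.card_eq_zero, Finset.filter_eq_empty_iff]
    exact fun i hi hp => h (hpq i hi π hp)

/-- Double counting of pairs, when every index occurs equally often. -/
theorem card_mul_permCount {ι : Type*} {I : Finset ι} {p : ι → Equiv.Perm (Fin n) → Prop}
    {q : Equiv.Perm (Fin n) → Prop} {c k : ℕ} (hpq : ∀ i ∈ I, ∀ π, p i π → q π)
    (hq : ∀ π, q π → (I.filter fun i => p i π).card = c) (hk : ∀ i ∈ I, permCount (p i) = k) :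
    I.card * k = c * permCount q := by
  rw [← sum_permCount hpq hq, Finset.sum_congr rfl hk, Finset.sum_const, smul_eq_mul]

theorem permCount_exists {ι : Type*} {I : Finset ι} {p : ι → Equiv.Perm (Fin n) → Prop}
    (h : ∀ i ∈ I, ∀ j ∈ I, ∀ π, p i π → p j π → i = j) :
    permCount (fun π => ∃ i ∈ I, p i π) = ∑ i ∈ I, permCount (p i) := by
  rw [sum_permCount (q := fun π => ∃ i ∈ I, p i π) (c := 1), one_mul]
  · exact fun i hi π hp => ⟨i, hi, hp⟩
  · rintro π ⟨i, hi, hp⟩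
    rw [Finset.card_eq_one]
    refine ⟨i, ?_⟩
    ext j
    simp only [Finset.mem_filter, Finset.mem_singleton]
    exact ⟨fun hj => h j hj.1 i hi π hj.2 hp, fun hj => hj ▸ ⟨hi, hp⟩⟩

theorem permCount_or {p q : Equiv.Perm (Fin n) → Prop} (h : ∀ π, p π → ¬ q π) :
    permCount (fun π => p π ∨ q π) = permCount p + permCount q := by
  unfold permCount
  rw [← Finset.card_union_of_disjoint (Finset.disjoint_filter.2 fun π _ => h π)]
  congr 1
  ext π
  simp

end permCount

variable {N : ℕ}

theorem permCount_apply_eq (i v : Fin (N + 1)) :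
    permCount (fun π : Equiv.Perm (Fin (N + 1)) => π i = v) = N.factorial := by
  classical
  have h := card_mul_permCount (I := Finset.univ)
    (p := fun (w : Fin (N + 1)) (π : Equiv.Perm (Fin (N + 1))) => π i = w) (q := fun _ => True)
    (c := 1) (k := permCount (fun π : Equiv.Perm (Fin (N + 1)) => π i = v)) (fun _ _ _ _ => trivial)
    (fun π _ => Finset.card_eq_one.2 ⟨π i, by ext; simp [eq_comm]⟩) (fun w _ =>
      (permCount_comp (Equiv.mulLeft (Equiv.swap w v)) _).symm.trans (permCount_congr fun π => by
        simp [Equiv.swap_apply_eq_iff]))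
  rw [permCount_true, Finset.card_univ, Fintype.card_fin, one_mul, Nat.factorial_succ] at h
  exact Nat.eq_of_mul_eq_mul_left (Nat.succ_pos N) h

/-- Given the event for `m`, exactly `N - s - m` of the `N - m` indices beyond `m` carry a value
above `s`, and by symmetry each is equally likely to do so. This is the ratio of consecutive
binomial quotients. -/
theorem permCount_first (s : Fin (N + 1)) {m : ℕ} (hm : m < N + 1) :
    permCount (fun ρ : Equiv.Perm (Fin (N + 1)) => ρ ⟨m, hm⟩ = s ∧
      ∀ i : Fin (N + 1), (i : ℕ) < m → s < ρ i) * N.choose m = N.factorial * (N - s).choose m := by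
  classical
  induction m with
  | zero => simp [permCount_apply_eq]
  | succ m ih =>
    have hm' : m < N + 1 := by omega
    specialize ih hm'
    set G : Equiv.Perm (Fin (N + 1)) → Prop := fun ρ =>
      ρ ⟨m, hm'⟩ = s ∧ ∀ i : Fin (N + 1), (i : ℕ) < m → s < ρ i with hG
    have h := card_mul_permCount (I := Finset.Ioi (⟨m, hm'⟩ : Fin (N + 1)))
      (p := fun i ρ => G ρ ∧ s < ρ i) (q := G) (c := N - s - m)
      (k := permCount (fun ρ : Equiv.Perm (Fin (N + 1)) =>
        ρ ⟨m + 1, hm⟩ = s ∧ ∀ i : Fin (N + 1), (i : ℕ) < m + 1 → s < ρ i)) (fun _ _ _ h => h.1) ?_ ?_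
    · rw [Fin.card_Ioi, show N + 1 - 1 - m = N - m by omega] at h
      refine Nat.eq_of_mul_eq_mul_right (Nat.succ_pos m) ?_
      rw [mul_assoc, Nat.choose_succ_right_eq, mul_assoc, Nat.choose_succ_right_eq, ← mul_assoc,
        mul_right_comm, mul_comm (permCount _), h, mul_assoc, ih]
      ring
    · intro ρ hρ
      simp only [hρ, true_and]
      have h1 : (Finset.univ.filter fun i => s < ρ i).card = N - s := by
        have : (Finset.univ.filter fun i => s < ρ i).map ρ.toEmbedding = Finset.Ioi s := by
          ext v
          simp only [Finset.mem_map, Finset.mem_filter, Finset.mem_univ, true_and, Finset.mem_Ioi,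
            Equiv.coe_toEmbedding]
          exact ⟨by rintro ⟨i, hi, rfl⟩; exact hi, fun hv => ⟨ρ.symm v, by simpa using hv, by simp⟩⟩
        rw [← Finset.card_map, this, Fin.card_Ioi]
        omega
      have h2 : (Finset.univ.filter fun i => s < ρ i) =
          Finset.Iio (⟨m, hm'⟩ : Fin (N + 1)) ∪
            (Finset.Ioi (⟨m, hm'⟩ : Fin (N + 1))).filter fun i => s < ρ i := by
        ext i
        simp only [Finset.mem_filter, Finset.mem_univ, true_and, Finset.mem_union, Finset.mem_Iio,
          Finset.mem_Ioi]
        constructor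
        · intro hi
          rcases lt_trichotomy i ⟨m, hm'⟩ with h | h | h
          · exact Or.inl h
          · subst h; exact absurd (hρ.1 ▸ hi) (lt_irrefl _)
          · exact Or.inr ⟨h, hi⟩
        · rintro (h | h)
          · exact hρ.2 i (Fin.lt_def.1 h)
          · exact h.2
      rw [h2, Finset.card_union_of_disjoint, Fin.card_Iio] at h1
      · simp only at h1; omega
      · rw [Finset.disjoint_left]
        simp only [Finset.mem_Iio, Finset.mem_filter, Finset.mem_Ioi]
        exact fun i h1 h2 => lt_asymm h1 h2.1
    · intro i hi
      rw [Finset.mem_Ioi] at hi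
      set M : Fin (N + 1) := ⟨m, hm'⟩
      set M' : Fin (N + 1) := ⟨m + 1, hm⟩ with hM'
      have hMM' : M < M' := Fin.lt_def.2 (Nat.lt_succ_self m)
      have step1 : permCount (fun ρ => G ρ ∧ s < ρ i) = permCount (fun ρ => G ρ ∧ s < ρ M') := by
        rw [← permCount_comp (Equiv.mulRight (Equiv.swap i M'))]
        refine permCount_congr fun ρ => ?_
        simp only [hG, Equiv.coe_mulRight, Equiv.Perm.mul_apply, Equiv.swap_apply_left]
        rw [Equiv.swap_apply_of_ne_of_ne hi.ne hMM'.ne]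
        refine and_congr_left fun _ => and_congr_right fun _ => forall₂_congr fun j hj => ?_
        have hjM : j < M := Fin.lt_def.2 hj
        rw [Equiv.swap_apply_of_ne_of_ne (hjM.trans hi).ne (hjM.trans hMM').ne]
      -- Exchanging the entries at `m` and `m + 1` moves `s` to index `m + 1` and puts a larger
      -- value at `m`.
      rw [step1, ← permCount_comp (Equiv.mulRight (Equiv.swap M M'))]
      refine permCount_congr fun ρ => ?_
      simp only [hG, Equiv.coe_mulRight, Equiv.Perm.mul_apply, Equiv.swap_apply_left,
        Equiv.swap_apply_right]
      have hfix : ∀ j : Fin (N + 1), (j : ℕ) < m → Equiv.swap M M' j = j := fun j hj => by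
        have hjM : j < M := Fin.lt_def.2 hj
        rw [Equiv.swap_apply_of_ne_of_ne hjM.ne (hjM.trans hMM').ne]
      constructor
      · rintro ⟨⟨h1, h2⟩, h3⟩
        refine ⟨h1, fun j hj => ?_⟩
        rcases Nat.lt_succ_iff_lt_or_eq.1 hj with h | h
        · have := h2 j h; rwa [hfix j h] at this
        · rwa [show j = M from Fin.ext h]
      · rintro ⟨h1, h2⟩
        refine ⟨⟨h1, fun j hj => ?_⟩, h2 M (Nat.lt_succ_self m)⟩
        rw [hfix j hj]
        exact h2 j (hj.trans (Nat.lt_succ_self m))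

/-- At time `s` the candidate of rank `m` shows up, and is the best so far. -/
def RecordAt (s m : Fin (N + 1)) (π : Equiv.Perm (Fin (N + 1))) : Prop :=
  π s = m ∧ ∀ j, j < s → m < π j

/-- Inversion turns "best so far at time `s`" into "every better rank appears after `s`", the event
of `permCount_first`. -/
theorem permCount_recordAt (s m : Fin (N + 1)) :
    permCount (RecordAt s m) * N.choose m = N.factorial * (N - s).choose m := by
  rw [← permCount_first s m.2, ← permCount_comp (Equiv.inv _)]
  congr 1
  refine permCount_congr fun ρ => ?_
  simp only [RecordAt, Equiv.inv_apply, Fin.eta, ← Fin.lt_def]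
  rw [Equiv.Perm.inv_eq_iff_eq, eq_comm]
  refine and_congr_right fun h => ⟨fun H i hi => ?_, fun H j hj => ?_⟩
  · rcases lt_trichotomy s (ρ i) with h' | h' | h'
    · exact h'
    · rw [← h, ρ.injective.eq_iff] at h'; exact absurd h' hi.ne'
    · have := H _ h'
      rw [Equiv.Perm.inv_def, Equiv.symm_apply_apply] at this
      exact absurd this (lt_asymm hi)
  · rcases lt_trichotomy m (ρ⁻¹ j) with h' | h' | h'
    · exact h'
    · rw [h', Equiv.Perm.inv_def, Equiv.apply_symm_apply] at h; exact absurd h hj.ne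
    · have := H _ h'
      rw [Equiv.Perm.inv_def, Equiv.apply_symm_apply] at this
      exact absurd this (lt_asymm hj)

/-- Among the times before `s`, the best candidate shows up at time `i`. -/
def BestBefore (s i : Fin (N + 1)) (π : Equiv.Perm (Fin (N + 1))) : Prop :=
  i < s ∧ ∀ j, j < s → π i ≤ π j

theorem BestBefore.unique {s i j : Fin (N + 1)} {π : Equiv.Perm (Fin (N + 1))}
    (hi : BestBefore s i π) (hj : BestBefore s j π) : i = j :=
  π.injective (le_antisymm (hi.2 j hj.1) (hj.2 i hi.1))

theorem exists_bestBefore {s : Fin (N + 1)} (hs : 0 < s) (π : Equiv.Perm (Fin (N + 1))) :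
    ∃ i, BestBefore s i π := by
  obtain ⟨i, hi, h⟩ := Finset.exists_min_image (Finset.Iio s) π ⟨0, by simpa using hs⟩
  exact ⟨i, Finset.mem_Iio.1 hi, fun j hj => h j (Finset.mem_Iio.2 hj)⟩

/-- Permuting the entries before `s` preserves `RecordAt s m`, so the best of them is equally likely
to sit at each of the `s` times. -/
theorem permCount_recordAt_bestBefore {s i : Fin (N + 1)} (m : Fin (N + 1)) (hi : i < s) :
    s * permCount (fun π => RecordAt s m π ∧ BestBefore s i π) = permCount (RecordAt s m) := by
  classical
  have h := card_mul_permCount (I := Finset.Iio s)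
    (p := fun j π => RecordAt s m π ∧ BestBefore s j π) (q := RecordAt s m) (c := 1)
    (k := permCount (fun π => RecordAt s m π ∧ BestBefore s i π)) (fun _ _ _ h => h.1) ?_ ?_
  · rwa [Fin.card_Iio, one_mul] at h
  · intro π hπ
    obtain ⟨j, hj⟩ := exists_bestBefore (i.zero_le.trans_lt hi) π
    rw [Finset.card_eq_one]
    refine ⟨j, ?_⟩
    ext j'
    simp only [Finset.mem_filter, Finset.mem_Iio, Finset.mem_singleton]
    exact ⟨fun h => h.2.2.unique hj, fun h => h ▸ ⟨hj.1, hπ, hj⟩⟩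
  · intro j hj
    rw [Finset.mem_Iio] at hj
    rw [← permCount_comp (Equiv.mulRight (Equiv.swap i j))]
    have hlt : ∀ k, Equiv.swap i j k < s ↔ k < s := by
      intro k
      rw [Equiv.swap_apply_def]
      split_ifs with h1 h2
      · simp [h1, hi, hj]
      · simp [h2, hi, hj]
      · rfl
    have hall : ∀ (P : Fin (N + 1) → Prop),
        (∀ k, k < s → P (Equiv.swap i j k)) ↔ ∀ k, k < s → P k := by
      intro P
      constructor
      · intro H k hk
        simpa using H (Equiv.swap i j k) ((hlt k).2 hk)
      · exact fun H k hk => H _ ((hlt k).2 hk)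
    refine permCount_congr fun π => ?_
    simp only [RecordAt, BestBefore, Equiv.coe_mulRight, Equiv.Perm.mul_apply,
      Equiv.swap_apply_right, hi, hj, true_and]
    rw [Equiv.swap_apply_of_ne_of_ne hi.ne' hj.ne', hall (fun k => m < π k),
      hall (fun k => π i ≤ π k)]

theorem permCount_zero_last {i m : Fin (N + 1)} (hi : i < Fin.last N) (hm : m ≠ 0) :
    N * permCount (fun π : Equiv.Perm (Fin (N + 1)) => π (Fin.last N) = m ∧ π i = 0) =
      N.factorial := by
  classical
  have h := card_mul_permCount (I := Finset.Iio (Fin.last N))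
    (p := fun j (π : Equiv.Perm (Fin (N + 1))) => π (Fin.last N) = m ∧ π j = 0)
    (q := fun π => π (Fin.last N) = m) (c := 1)
    (k := permCount (fun π : Equiv.Perm (Fin (N + 1)) => π (Fin.last N) = m ∧ π i = 0))
    (fun _ _ _ h => h.1) ?_ ?_
  · rwa [Fin.card_Iio, Fin.val_last, one_mul, permCount_apply_eq] at h
  · intro π hπ
    rw [Finset.card_eq_one]
    refine ⟨π.symm 0, ?_⟩
    ext j
    simp only [Finset.mem_filter, Finset.mem_Iio, Finset.mem_singleton, hπ, true_and]
    rw [Equiv.eq_symm_apply]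
    refine and_iff_right_of_imp fun h => lt_of_le_of_ne (Fin.le_last j) fun h' => hm ?_
    rw [← hπ, ← h', h]
  · intro j hj
    rw [Finset.mem_Iio] at hj
    rw [← permCount_comp (Equiv.mulRight (Equiv.swap i j))]
    refine permCount_congr fun π => ?_
    simp only [Equiv.coe_mulRight, Equiv.Perm.mul_apply, Equiv.swap_apply_right]
    rw [Equiv.swap_apply_of_ne_of_ne hi.ne' hj.ne']

/-! ### The rank selected by the optimal rule -/

theorem acceptable_iff (σ τ : Equiv.Perm (Fin (N + 1))) (k : Fin (N + 1)) :
    Acceptable σ τ k ↔ observed N ≤ k ∧ ∀ j, j < k → (σ⁻¹ * τ) k < (σ⁻¹ * τ) j := by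
  unfold Acceptable IsRecord
  rw [← observed_add_one, Nat.add_le_add_iff_right]
  rfl

/-- The best candidate before `s` is itself a record, hence acceptable unless it was only observed.
-/
theorem exists_bestBefore_observed_iff (hN : 2 ≤ N) (σ τ : Equiv.Perm (Fin (N + 1)))
    {s : Fin (N + 1)} (hs : observed N ≤ s) :
    (∀ k, k < s → ¬ Acceptable σ τ k) ↔
      ∃ i : Fin (N + 1), (i : ℕ) < observed N ∧ BestBefore s i (σ⁻¹ * τ) := by
  have hT := observed_pos hN
  constructor
  · intro h
    obtain ⟨i, hi⟩ := exists_bestBefore (s := s) (show 0 < (s : ℕ) by omega) (σ⁻¹ * τ)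
    refine ⟨i, ?_, hi⟩
    by_contra! hcon
    refine h i hi.1 ((acceptable_iff σ τ i).2 ⟨hcon, fun j hj => ?_⟩)
    exact lt_of_le_of_ne (hi.2 j (hj.trans hi.1)) fun h' => hj.ne' ((Equiv.injective _) h')
  · rintro ⟨i, hiT, hi⟩ k hk hacc
    rw [acceptable_iff] at hacc
    exact (hi.2 k hk).not_gt (hacc.2 i (Fin.lt_def.2 (hiT.trans_le hacc.1)))

theorem not_exists_acceptable_iff (σ τ : Equiv.Perm (Fin (N + 1))) :
    (¬ ∃ k, Acceptable σ τ k) ↔ ∃ i : Fin (N + 1), (i : ℕ) < observed N ∧ (σ⁻¹ * τ) i = 0 := by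
  constructor
  · intro h
    refine ⟨(σ⁻¹ * τ).symm 0, ?_, by simp⟩
    by_contra! hcon
    refine h ⟨_, (acceptable_iff σ τ _).2 ⟨hcon, fun j hj => ?_⟩⟩
    rw [Equiv.apply_symm_apply, Fin.pos_iff_ne_zero]
    exact fun h' => hj.ne (by rw [← h', Equiv.symm_apply_apply])
  · rintro ⟨i, hiT, hi⟩ ⟨k, hk⟩
    rw [acceptable_iff] at hk
    have := hk.2 i (Fin.lt_def.2 (hiT.trans_le hk.1))
    rw [hi] at this
    exact absurd this (Fin.not_lt_zero _)

theorem optimalStop_eq_iff {σ τ : Equiv.Perm (Fin (N + 1))} (h : ∃ k, Acceptable σ τ k)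
    {s : Fin (N + 1)} :
    optimalStop σ τ = s ↔ Acceptable σ τ s ∧ ∀ k, k < s → ¬ Acceptable σ τ k := by
  classical
  have hs : optimalStop σ τ = Fin.find (Acceptable σ τ) h := by
    simp only [optimalStop, h, dif_pos]
  rw [hs]
  constructor
  · rintro rfl
    exact ⟨Fin.find_spec h, fun k hk hacc => hk.not_ge (Fin.find_le_of_pos h hacc)⟩
  · rintro ⟨h1, h2⟩
    refine le_antisymm (Fin.find_le_of_pos h h1) ?_
    by_contra! hlt
    exact h2 _ hlt (Fin.find_spec h)

theorem optimalStop_eq_last {σ τ : Equiv.Perm (Fin (N + 1))} (h : ¬ ∃ k, Acceptable σ τ k) :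
    optimalStop σ τ = Fin.last N := by
  simp only [optimalStop, h, dif_neg, not_false_eq_true]
  rfl

theorem selects_iff (hN : 2 ≤ N) (σ τ : Equiv.Perm (Fin (N + 1))) (m : Fin (N + 1)) :
    (σ⁻¹ * τ) (optimalStop σ τ) = m ↔
      (∃ s ∈ Finset.univ.filter fun s : Fin (N + 1) => observed N ≤ s,
        ∃ i ∈ Finset.univ.filter fun i : Fin (N + 1) => (i : ℕ) < observed N,
          RecordAt s m (σ⁻¹ * τ) ∧ BestBefore s i (σ⁻¹ * τ)) ∨
      ∃ i ∈ Finset.univ.filter fun i : Fin (N + 1) => (i : ℕ) < observed N,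
        (σ⁻¹ * τ) (Fin.last N) = m ∧ (σ⁻¹ * τ) i = 0 := by
  simp only [Finset.mem_filter, Finset.mem_univ, true_and]
  constructor
  · intro hm
    by_cases h : ∃ k, Acceptable σ τ k
    · left
      obtain ⟨h1, h2⟩ := (optimalStop_eq_iff h).1 rfl
      have h3 := (acceptable_iff _ _ _).1 h1
      obtain ⟨i, hi, hb⟩ := (exists_bestBefore_observed_iff hN σ τ h3.1).1 h2
      exact ⟨_, h3.1, i, hi, ⟨hm, hm ▸ h3.2⟩, hb⟩
    · right
      rw [optimalStop_eq_last h] at hm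
      obtain ⟨i, hi, h0⟩ := (not_exists_acceptable_iff σ τ).1 h
      exact ⟨i, hi, hm, h0⟩
  · rintro (⟨s, hs, i, hi, hr, hb⟩ | ⟨i, hi, hm, h0⟩)
    · have hacc : Acceptable σ τ s := (acceptable_iff _ _ _).2 ⟨hs, fun j hj => by
        rw [hr.1]; exact hr.2 j hj⟩
      rw [(optimalStop_eq_iff ⟨s, hacc⟩).2
        ⟨hacc, (exists_bestBefore_observed_iff hN σ τ hs).2 ⟨i, hi, hb⟩⟩]
      exact hr.1
    · rw [optimalStop_eq_last ((not_exists_acceptable_iff σ τ).2 ⟨i, hi, h0⟩)]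
      exact hm

theorem card_filter_val_lt_observed :
    (Finset.univ.filter fun i : Fin (N + 1) => (i : ℕ) < observed N).card = observed N := by
  have := observed_le N
  rw [Fin.card_filter_val_lt]
  omega

theorem permCount_selects (hN : 2 ≤ N) (σ : Equiv.Perm (Fin (N + 1))) (m : Fin (N + 1)) :
    (permCount (fun τ : Equiv.Perm (Fin (N + 1)) => (σ⁻¹ * τ) (optimalStop σ τ) = m) : ℝ) =
      N.factorial * (observed N * rankWeight N (observed N) m) := by
  have hT := observed_pos hN
  have hTN := two_mul_observed_le hN
  have hNR : (0 : ℝ) < N := by exact_mod_cast (by omega : 0 < N)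
  rw [(permCount_congr (selects_iff hN σ · m)).trans (permCount_comp (Equiv.mulLeft σ⁻¹) (fun π =>
      (∃ s ∈ Finset.univ.filter fun s : Fin (N + 1) => observed N ≤ s,
        ∃ i ∈ Finset.univ.filter fun i : Fin (N + 1) => (i : ℕ) < observed N,
          RecordAt s m π ∧ BestBefore s i π) ∨
      ∃ i ∈ Finset.univ.filter fun i : Fin (N + 1) => (i : ℕ) < observed N,
        π (Fin.last N) = m ∧ π i = 0))]
  rw [permCount_or, permCount_exists, permCount_exists]
  rotate_left
  · exact fun i _ j _ π hi hj => π.injective (hi.2.trans hj.2.symm)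
  · rintro s - s' - π ⟨i, -, hi⟩ ⟨i', -, hi'⟩
    exact π.injective (hi.1.1.trans hi'.1.1.symm)
  · rintro π ⟨s, hs, i, -, hr, -⟩ ⟨j, hj, -, h0⟩
    simp only [Finset.mem_filter, Finset.mem_univ, true_and] at hs hj
    have := hr.2 j (Fin.lt_def.2 (hj.trans_le hs))
    rw [h0] at this
    exact Fin.not_lt_zero _ this
  have h1 : ∀ s ∈ Finset.univ.filter (fun s : Fin (N + 1) => observed N ≤ s),
      (permCount (fun π => ∃ i ∈ Finset.univ.filter fun i : Fin (N + 1) => (i : ℕ) < observed N,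
          RecordAt s m π ∧ BestBefore s i π) : ℝ) =
      N.factorial * observed N * ((1 / ((s : ℕ) : ℝ)) * ((N - s).choose m / N.choose m)) := by
    intro s hs
    simp only [Finset.mem_filter, Finset.mem_univ, true_and] at hs
    have hsR : (0 : ℝ) < ((s : ℕ) : ℝ) := by exact_mod_cast (by omega : 0 < (s : ℕ))
    have hc : (0 : ℝ) < (N.choose m : ℝ) := by
      exact_mod_cast Nat.choose_pos (Nat.lt_succ_iff.1 m.2)
    rw [permCount_exists fun i _ j _ π hi hj => hi.2.unique hj.2]
    push_cast
    have h2 : ∀ i ∈ Finset.univ.filter (fun i : Fin (N + 1) => (i : ℕ) < observed N),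
        (permCount (fun π => RecordAt s m π ∧ BestBefore s i π) : ℝ) =
          N.factorial * ((1 / ((s : ℕ) : ℝ)) * ((N - s).choose m / N.choose m)) := by
      intro i hi
      simp only [Finset.mem_filter, Finset.mem_univ, true_and] at hi
      have h3 := permCount_recordAt_bestBefore m (Fin.lt_def.2 (hi.trans_le hs))
      have h4 := permCount_recordAt s m
      rw [← h3] at h4
      have h5 : ((s : ℕ) : ℝ) * permCount (fun π => RecordAt s m π ∧ BestBefore s i π) *
          N.choose m = N.factorial * (N - s).choose m := by exact_mod_cast h4
      field_simp
      linarith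
    rw [Finset.sum_congr rfl h2, Finset.sum_const, card_filter_val_lt_observed, nsmul_eq_mul]
    ring
  have h2 : ∀ i ∈ Finset.univ.filter (fun i : Fin (N + 1) => (i : ℕ) < observed N),
      (permCount (fun π : Equiv.Perm (Fin (N + 1)) => π (Fin.last N) = m ∧ π i = 0) : ℝ) =
        (if m = 0 then 0 else (N.factorial : ℝ) * (1 / N) : ℝ) := by
    intro i hi
    simp only [Finset.mem_filter, Finset.mem_univ, true_and] at hi
    have hil : i < Fin.last N := Fin.lt_def.2 (by rw [Fin.val_last]; omega)
    split_ifs with hm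
    · subst hm
      rw [permCount_eq_zero fun π h => hil.ne (π.injective (h.2.trans h.1.symm)), Nat.cast_zero]
    · have h := permCount_zero_last hil hm
      have h' : (N : ℝ) * permCount (fun π : Equiv.Perm (Fin (N + 1)) =>
        π (Fin.last N) = m ∧ π i = 0) = N.factorial := by exact_mod_cast h
      field_simp
      linarith
  push_cast
  rw [Finset.sum_congr rfl h1, Finset.sum_congr rfl h2, ← Finset.mul_sum, Finset.sum_const,
    card_filter_val_lt_observed, nsmul_eq_mul, Finset.sum_filter,
    Fin.sum_univ_eq_sum_range (fun s => if observed N ≤ s then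
      (1 / (s : ℝ)) * ((N - s).choose m / N.choose m) else 0), ← Finset.sum_filter,
    show (Finset.range (N + 1)).filter (observed N ≤ ·) = Finset.Ico (observed N) (N + 1) by
      ext; simp [and_comm], Finset.sum_Ico_succ_top (by omega), rankWeight, Nat.sub_self]
  -- The term `s = N` gives `1 / N` only for `m = 0`, the forced choice at the last time only for `m
  -- ≠ 0`; together they form the constant `1 / N` in `rankWeight`.
  split_ifs with hm
  · subst hm; simp; ring
  · rw [Nat.choose_eq_zero_of_lt (Nat.pos_of_ne_zero fun h => hm (Fin.ext h))]
    simp; ring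

/-! ### Laws of the optimal rule, the blind choice and their mix -/

theorem prob_law (M : StoppingTime (N + 1)) (σ : Equiv.Perm (Fin (N + 1))) (c : Fin (N + 1)) :
    (M.law σ c).toReal = permCount (fun τ => τ (M.time σ τ) = c) / (N + 1).factorial := by
  classical
  rw [← PMF.toOuterMeasure_apply_singleton, StoppingTime.law, PMF.toOuterMeasure_map_apply,
    PMF.toOuterMeasure_uniformOfFintype_apply, ENNReal.toReal_div, ENNReal.toReal_natCast,
    ENNReal.toReal_natCast, Fintype.card_perm, Fintype.card_fin]
  congr 2
  rw [permCount, Fintype.card_subtype]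
  congr 1

/-- The probability that the optimal algorithm selects the candidate of (0-based) rank `m`. -/
noncomputable def selection (N m : ℕ) : ℝ :=
  (observed N : ℝ) / (N + 1) * rankWeight N (observed N) m

theorem optimal_law (hN : 2 ≤ N) (σ : Equiv.Perm (Fin (N + 1))) (c : Fin (N + 1)) :
    ((optimal (N + 1)).law σ c).toReal = selection N (σ.symm c) := by
  rw [prob_law, permCount_congr (p := fun τ => τ ((optimal (N + 1)).time σ τ) = c)
    (q := fun τ : Equiv.Perm (Fin (N + 1)) => (σ⁻¹ * τ) (optimalStop σ τ) = σ.symm c)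
    (fun τ => (σ.symm.injective.eq_iff).symm), permCount_selects hN, selection,
    Nat.factorial_succ]
  push_cast
  field_simp

theorem blind_law (σ : Equiv.Perm (Fin (N + 1))) (c : Fin (N + 1)) :
    ((blind (N + 1)).law σ c).toReal = 1 / (N + 1) := by
  rw [prob_law]
  change (permCount (fun τ : Equiv.Perm (Fin (N + 1)) => τ 0 = c) : ℝ) / _ = _
  rw [permCount_apply_eq, Nat.factorial_succ]
  push_cast
  field_simp

open Classical in
theorem prob_eq_sum {n : ℕ} (P : PMF (Fin n)) (S : Set (Fin n)) :
    prob P S = ∑ c, if c ∈ S then (P c).toReal else 0 := by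
  rw [prob, PMF.toOuterMeasure_apply_fintype, ENNReal.toReal_sum]
  · refine Finset.sum_congr rfl fun c _ => ?_
    rw [Set.indicator_apply]
    split_ifs <;> rfl
  · intro c _
    rw [Set.indicator_apply]
    split_ifs
    · exact P.apply_ne_top c
    · exact ENNReal.zero_ne_top

theorem pMix_law {n : ℕ} {p : ℝ≥0} (hp : p ≤ 1) (M₁ M₂ : StoppingTime n)
    (σ : Equiv.Perm (Fin n)) (c : Fin n) :
    (randomizedLaw (pMix p hp M₁ M₂) σ c).toReal =
      p * (M₁.law σ c).toReal + (1 - p) * (M₂.law σ c).toReal := by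
  rw [randomizedLaw, pMix, PMF.bind_map, PMF.bind_apply, tsum_fintype, Fintype.sum_bool]
  simp only [coin, PMF.ofFintype_apply, Function.comp, if_true, Bool.false_eq_true, if_false]
  rw [ENNReal.toReal_add (ENNReal.mul_ne_top ENNReal.coe_ne_top (PMF.apply_ne_top _ _))
    (ENNReal.mul_ne_top ENNReal.coe_ne_top (PMF.apply_ne_top _ _)), ENNReal.toReal_mul,
    ENNReal.toReal_mul, ENNReal.coe_toReal, ENNReal.coe_toReal, NNReal.coe_sub hp, NNReal.coe_one]

theorem r_eq_selection (hN : 2 ≤ N) (σ : Equiv.Perm (Fin (N + 1))) {m : ℕ} (hm : m ≤ N) :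
    r σ (m + 1) = selection N m := by
  classical
  rw [r, prob_eq_sum, Finset.sum_eq_single (σ ⟨m, by omega⟩)]
  · rw [if_pos (by simp), optimal_law hN, Equiv.symm_apply_apply]
  · intro c _ hc
    refine if_neg fun h => hc ?_
    rw [← Equiv.symm_apply_eq]
    exact Fin.ext (Nat.succ_injective h)
  · simp

theorem selection_pos (hN : 2 ≤ N) (m : ℕ) : 0 < selection N m := by
  have hT : (0 : ℝ) < observed N := by exact_mod_cast observed_pos hN
  have := rankWeight_pos (T := observed N) (by omega : 0 < N) m
  unfold selection
  positivity

theorem selection_anti (hN : 2 ≤ N) {i j : ℕ} (hij : i ≤ j) (hj : j ≤ N) :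
    selection N j ≤ selection N i := by
  induction j, hij using Nat.le_induction with
  | base => rfl
  | succ k _ ih =>
    refine le_trans ?_ (ih (by omega))
    exact mul_le_mul_of_nonneg_left (rankWeight_succ_le (observed_pos hN) (observed_le N) hj)
      (by positivity)

theorem selection_mul_le (hN : 6 ≤ N) {m l : ℕ} (hml : m + l ≤ N) :
    selection N m * selection N l ≤ selection N 0 * selection N (m + l) := by
  have h1 := two_mul_observed_le (N := N) (by omega)
  have h2 := le_three_mul_observed (N := N) (by omega)
  refine mul_le_mul_of_log_convex (N := N) (selection_pos (by omega)) (fun k hk => ?_) hml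
  have h := rankWeight_sq_le (by omega) h2 hN (one_lt_rankWeight_zero (by omega)) (by omega) hk
  unfold selection
  rw [mul_pow, mul_mul_mul_comm, ← sq]
  exact mul_le_mul_of_nonneg_left h (by positivity)

/-- The law of the rank of the candidate selected by the `p`-mix. -/
noncomputable def mixSelection (N : ℕ) (p : ℝ) (m : ℕ) : ℝ :=
  p * selection N m + (1 - p) * (1 / (N + 1))

theorem mixSelection_nonneg (hN : 2 ≤ N) {p : ℝ} (hp₀ : 0 ≤ p) (hp₁ : p ≤ 1) (m : ℕ) :
    0 ≤ mixSelection N p m := by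
  have := selection_pos hN m
  have := sub_nonneg.2 hp₁
  unfold mixSelection
  positivity

theorem mixSelection_zero_pos (hN : 2 ≤ N) {p : ℝ} (hp₀ : 0 ≤ p) (hp₁ : p ≤ 1) :
    0 < mixSelection N p 0 := by
  have h1 := selection_pos hN 0
  have h2 := sub_nonneg.2 hp₁
  unfold mixSelection
  rcases hp₀.eq_or_lt with rfl | h
  · rw [zero_mul, zero_add, sub_zero, one_mul]; positivity
  · positivity

theorem mixSelection_anti (hN : 2 ≤ N) {p : ℝ} (hp₀ : 0 ≤ p) {i j : ℕ} (hij : i ≤ j)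
    (hj : j ≤ N) : mixSelection N p j ≤ mixSelection N p i :=
  add_le_add_left (mul_le_mul_of_nonneg_left (selection_anti hN hij hj) hp₀) _

/-- The cross terms with the uniform part need `s m + s l ≤ s 0 + s (m + l)` for `s = selection N`.
This follows from `(s 0 - s m) * (s 0 - s l) ≥ 0` and the product inequality for `s`. -/
theorem mixSelection_mul_le (hN : 6 ≤ N) {p : ℝ} (hp₀ : 0 ≤ p) (hp₁ : p ≤ 1) {m l : ℕ}
    (hml : m + l ≤ N) :
    mixSelection N p m * mixSelection N p l ≤
      mixSelection N p 0 * mixSelection N p (m + l) := by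
  have h1 := selection_mul_le hN hml
  have h0 := selection_pos (N := N) (by omega) 0
  have h2 : selection N m + selection N l ≤ selection N 0 + selection N (m + l) := by
    refine le_of_mul_le_mul_left ?_ h0
    have := mul_nonneg
      (sub_nonneg.2 (selection_anti (by omega) (Nat.zero_le m) (by omega : m ≤ N)))
      (sub_nonneg.2 (selection_anti (by omega) (Nat.zero_le l) (by omega : l ≤ N)))
    linarith
  have hu : 0 ≤ (1 - p) * (1 / ((N : ℝ) + 1)) := mul_nonneg (sub_nonneg.2 hp₁) (by positivity)
  unfold mixSelection
  have h3 := mul_le_mul_of_nonneg_left h1 (sq_nonneg p)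
  have h4 := mul_le_mul_of_nonneg_left h2 (mul_nonneg hp₀ hu)
  linarith

/-- With `q = mixSelection N p`, supermultiplicativity gives `q 0 * (q i - E * q (i + d)) ≤ q i * (q
0 - E * q d)`, and `q i ≤ q 0`. -/
theorem mixSelection_sub_le (hN : 6 ≤ N) {p E δ : ℝ} (hp₀ : 0 ≤ p) (hp₁ : p ≤ 1) (hE : 1 ≤ E)
    (hδ : 0 ≤ δ) {l : ℕ} (hl : l ≤ N)
    (h : mixSelection N p 0 - E * mixSelection N p l ≤ δ) {i j : ℕ} (hij : i ≤ j) (hj : j ≤ N)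
    (hjl : j ≤ i + l) : mixSelection N p i - E * mixSelection N p j ≤ δ := by
  obtain ⟨d, rfl⟩ := Nat.exists_eq_add_of_le hij
  have hpos := mixSelection_zero_pos (N := N) (by omega) hp₀ hp₁
  have hi := mixSelection_nonneg (N := N) (by omega) hp₀ hp₁ i
  have h1 := mixSelection_anti (N := N) (by omega) hp₀ (by omega : d ≤ l) hl
  have h2 := mixSelection_anti (N := N) (by omega) hp₀ (Nat.zero_le i) (by omega : i ≤ N)
  have h3 := mixSelection_mul_le hN hp₀ hp₁ hj
  have h4 : mixSelection N p 0 - E * mixSelection N p d ≤ δ :=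
    le_trans (sub_le_sub_left (mul_le_mul_of_nonneg_left h1 (by linarith)) _) h
  refine le_of_mul_le_mul_left ?_ hpos
  calc mixSelection N p 0 * (mixSelection N p i - E * mixSelection N p (i + d))
      = mixSelection N p 0 * mixSelection N p i -
          E * (mixSelection N p 0 * mixSelection N p (i + d)) := by ring
    _ ≤ mixSelection N p 0 * mixSelection N p i -
          E * (mixSelection N p i * mixSelection N p d) :=
        sub_le_sub_left (mul_le_mul_of_nonneg_left h3 (by linarith)) _
    _ = mixSelection N p i * (mixSelection N p 0 - E * mixSelection N p d) := by ring
    _ ≤ mixSelection N p i * δ := mul_le_mul_of_nonneg_left h4 hi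
    _ ≤ mixSelection N p 0 * δ := mul_le_mul_of_nonneg_right h2 hδ

/-! ### From the rank law to differential privacy -/

theorem eq_or_eq_swap_mul_of_lDist_le_one {n l : ℕ} (hl : 1 ≤ l) {σ ρ : Equiv.Perm (Fin n)}
    (h : lDist l σ ρ ≤ 1) : σ = ρ ∨
      ∃ i j : Fin n, i < j ∧ (j : ℕ) ≤ i + l ∧ σ = Equiv.swap (ρ i) (ρ j) * ρ := by
  have hmem : SwapChain l (lDist l σ ρ) ρ σ := Nat.sInf_mem (exists_swapChain hl σ ρ)
  generalize lDist l σ ρ = k at h hmem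
  cases hmem with
  | refl => exact Or.inl rfl
  | step i j hij hjl h' =>
    cases h' with
    | refl => exact Or.inr ⟨i, j, hij, hjl, rfl⟩
    | step => omega

theorem isDP_of_rank_law {n l : ℕ} (hl : 1 ≤ l) {ε δ : ℝ} (hε : 0 ≤ ε) (hδ : 0 ≤ δ)
    {A : PMF (StoppingTime n)} {q : ℕ → ℝ} (hq : ∀ m, 0 ≤ q m)
    (hlaw : ∀ σ c, (randomizedLaw A σ c).toReal = q (σ.symm c))
    (hanti : ∀ i j, i ≤ j → j < n → q j ≤ q i)
    (hdiff : ∀ i j, i ≤ j → j < n → j ≤ i + l → q i - Real.exp ε * q j ≤ δ) :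
    IsDP (fun π ρ => (lDist l π ρ : ℝ)) ε δ A := by
  classical
  have hE : 1 ≤ Real.exp ε := Real.one_le_exp hε
  have hle : ∀ x, 0 ≤ x → x ≤ Real.exp ε * x := fun x hx => le_mul_of_one_le_left hx hE
  intro S σ ρ hd
  have hd' : lDist l σ ρ ≤ 1 := Nat.cast_le_one.1 hd
  rcases eq_or_eq_swap_mul_of_lDist_le_one hl hd' with rfl | ⟨i, j, hij, hjl, rfl⟩
  · exact (hle _ ENNReal.toReal_nonneg).trans (le_add_of_nonneg_right hδ)
  · rw [prob_eq_sum, prob_eq_sum, Finset.mul_sum, ← sub_le_iff_le_add', ← Finset.sum_sub_distrib]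
    -- Candidate `ρ j` rises to rank `i` and costs at most `δ`; `ρ i` falls and the others keep
    -- their rank, so their terms are nonpositive.
    calc _ ≤ ∑ c : Fin n, if c = ρ j then δ else 0 := Finset.sum_le_sum fun c _ => ?_
      _ = δ := by simp
    have hsymm : (Equiv.swap (ρ i) (ρ j) * ρ).symm c = ρ.symm (Equiv.swap (ρ i) (ρ j) c) := rfl
    rw [hlaw, hlaw, hsymm]
    by_cases hS : c ∈ S
    · rw [if_pos hS, if_pos hS]
      split_ifs with hc
      · rw [hc, Equiv.swap_apply_right, Equiv.symm_apply_apply, Equiv.symm_apply_apply]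
        exact hdiff i j hij.le j.2 hjl
      · rw [sub_nonpos]
        by_cases hci : c = ρ i
        · rw [hci, Equiv.swap_apply_left, Equiv.symm_apply_apply, Equiv.symm_apply_apply]
          exact (hanti i j hij.le j.2).trans (hle _ (hq _))
        · rw [Equiv.swap_apply_of_ne_of_ne hci hc]
          exact hle _ (hq _)
    · rw [if_neg hS, if_neg hS, mul_zero, sub_zero]
      split_ifs <;> simp [hδ]

/-- The left side is `p * (D + u) - u`, with `D = selection N 0 - E * selection N l` and `u = (E -
1) / (N + 1)`. If `D ≤ δ`, it is at most `p * δ - (1 - p) * u ≤ δ`. -/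
theorem mixSelection_zero_sub_le {p E δ : ℝ} (hp₀ : 0 ≤ p) (hp₁ : p ≤ 1) (hE : 1 ≤ E)
    (hδ : 0 ≤ δ) {l : ℕ}
    (h : δ < selection N 0 - E * selection N l →
      p ≤ (δ + (E - 1) / (N + 1)) / (selection N 0 - E * selection N l + (E - 1) / (N + 1))) :
    mixSelection N p 0 - E * mixSelection N p l ≤ δ := by
  have hu : 0 ≤ (E - 1) / ((N : ℝ) + 1) := div_nonneg (by linarith) (by positivity)
  have e : mixSelection N p 0 - E * mixSelection N p l =
      p * (selection N 0 - E * selection N l + (E - 1) / (N + 1)) - (E - 1) / (N + 1) := by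
    unfold mixSelection; ring
  rw [e]
  rcases lt_or_ge δ (selection N 0 - E * selection N l) with hlt | hge
  · have := h hlt
    rw [le_div_iff₀ (by linarith)] at this
    linarith
  · have h1 := mul_le_mul_of_nonneg_left hge hp₀
    have h2 := mul_le_mul_of_nonneg_right hp₁ hδ
    have h3 := mul_le_mul_of_nonneg_right hp₁ hu
    linarith

theorem isDP_pMix {n l : ℕ} [NeZero n] (hn : 7 ≤ n) (hl₀ : 1 ≤ l) (hl : l < n) {ε δ : ℝ}
    (hε : 0 ≤ ε) (hδ : 0 ≤ δ) {p : ℝ≥0} (hp : p ≤ 1) (σ : Equiv.Perm (Fin n))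
    (h : δ < r σ 1 - Real.exp ε * r σ (l + 1) → (p : ℝ) ≤ pBound σ l ε δ) :
    IsDP (fun π ρ => (lDist l π ρ : ℝ)) ε δ (pMix p hp (optimal n) (blind n)) := by
  obtain ⟨N, rfl⟩ : ∃ N, n = N + 1 := ⟨n - 1, by omega⟩
  have hE : 1 ≤ Real.exp ε := Real.one_le_exp hε
  have hp₀ : (0 : ℝ) ≤ p := p.2
  have hp₁ : (p : ℝ) ≤ 1 := by exact_mod_cast hp
  rw [pBound, r_eq_selection (by omega) σ (by omega : l ≤ N),
    show r σ 1 = selection N 0 from r_eq_selection (by omega) σ (Nat.zero_le N)] at h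
  push_cast at h
  refine isDP_of_rank_law hl₀ hε hδ (mixSelection_nonneg (N := N) (by omega) hp₀ hp₁) ?_
    (fun i j hij hj => mixSelection_anti (by omega) hp₀ hij (by omega))
    (fun i j hij hj hjl => mixSelection_sub_le (by omega) hp₀ hp₁ hE hδ (by omega)
      (mixSelection_zero_sub_le hp₀ hp₁ hE hδ h) hij (by omega) hjl)
  intro σ c
  rw [pMix_law, optimal_law (by omega), blind_law, mixSelection]

/-! ### Limits of the selection probabilities and of the bound -/

theorem tendsto_r (σ : ∀ n : ℕ+, Equiv.Perm (Fin n)) (m : ℕ) :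
    Tendsto (fun n : ℕ+ => r (σ n) (m + 1)) atTop (𝓝 (1 / Real.exp 1 * a (m + 1))) := by
  have hpred : Tendsto (fun n : ℕ+ => (n : ℕ) - 1) atTop atTop := by
    refine tendsto_atTop.2 fun b => ?_
    filter_upwards [eventually_ge_atTop b.succPNat] with n hn
    have : b.succ ≤ (n : ℕ) := hn
    omega
  refine ((tendsto_selection m).comp hpred).congr' ?_
  filter_upwards [eventually_ge_atTop (m + 2).succPNat] with n hn
  have hn' : (m + 2).succ ≤ (n : ℕ) := hn
  -- Stated for arbitrary `k` so that `k = N + 1` can be substituted although `σ n` depends on `n`.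
  have key : ∀ (k : ℕ) [NeZero k] (τ : Equiv.Perm (Fin k)), m + 3 ≤ k →
      selection (k - 1) m = r τ (m + 1) := by
    intro k _ τ hk
    obtain ⟨N, rfl⟩ : ∃ N, k = N + 1 := ⟨k - 1, by omega⟩
    exact (r_eq_selection (by omega) τ (by omega)).symm
  exact key n (σ n) hn'

theorem tendsto_one_div_pnat : Tendsto (fun n : ℕ+ => 1 / ((n : ℕ) : ℝ)) atTop (𝓝 0) := by
  refine (tendsto_one_div_atTop_nhds_zero_nat (𝕜 := ℝ)).comp (tendsto_atTop.2 fun b => ?_)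
  filter_upwards [eventually_ge_atTop b.succPNat] with n hn
  exact (Nat.le_succ b).trans hn

theorem tendsto_r_sub (σ : ∀ n : ℕ+, Equiv.Perm (Fin n)) (l : ℕ) (ε : ℝ) :
    Tendsto (fun n : ℕ+ => r (σ n) 1 - Real.exp ε * r (σ n) (l + 1)) atTop
      (𝓝 ((1 - Real.exp ε * a (l + 1)) / Real.exp 1)) := by
  have h := (tendsto_r σ 0).sub ((tendsto_r σ l).const_mul (Real.exp ε))
  rw [zero_add, a_one] at h
  convert h using 2
  ring

theorem tendsto_pBound (σ : ∀ n : ℕ+, Equiv.Perm (Fin n)) {l : ℕ} {ε : ℝ} (δ : ℝ)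
    (h : Real.exp ε * a (l + 1) ≠ 1) :
    Tendsto (fun n : ℕ+ => pBound (σ n) l ε δ) atTop
      (𝓝 (Real.exp 1 * δ / (1 - Real.exp ε * a (l + 1)))) := by
  have h0 : 1 - Real.exp ε * a (l + 1) ≠ 0 := sub_ne_zero.2 h.symm
  have hc := tendsto_one_div_pnat.const_mul (Real.exp ε - 1)
  have h1 := (hc.const_add δ).div ((tendsto_r_sub σ l ε).add hc)
    (by rw [mul_zero, add_zero]; exact div_ne_zero h0 (Real.exp_pos 1).ne')
  rw [mul_zero, add_zero, add_zero, div_div_eq_mul_div, mul_comm δ] at h1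
  refine h1.congr fun n => ?_
  simp only [Pi.div_apply, pBound, mul_one_div]

end Secretary

theorem mainTheorem9 (l : ℕ) (hl : 1 ≤ l) (ε δ : ℝ) (hε : 0 ≤ ε) (hδ₀ : 0 ≤ δ) (hδ₁ : δ ≤ 1)
    (σ : ∀ n : ℕ+, Equiv.Perm (Fin n)) :
    (∀ n : ℕ+, 7 ≤ (n : ℕ) → l < (n : ℕ) → ∀ (p : ℝ≥0) (hp : p ≤ 1),
      (δ < Secretary.r (σ n) 1 - Real.exp ε * Secretary.r (σ n) (l + 1) →
        (p : ℝ) ≤ Secretary.pBound (σ n) l ε δ) →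
      Secretary.IsDP (fun π ρ => (Secretary.lDist l π ρ : ℝ)) ε δ
        (Secretary.pMix p hp (Secretary.optimal n) (Secretary.blind n))) ∧
    (0 < δ →
      (∃ᶠ n : ℕ+ in atTop,
        δ < Secretary.r (σ n) 1 - Real.exp ε * Secretary.r (σ n) (l + 1)) →
      0 < 1 - Real.exp ε * Secretary.a (l + 1) ∧
      Tendsto (fun n : ℕ+ => Secretary.pBound (σ n) l ε δ /
        (Real.exp 1 * δ / (1 - Real.exp ε * Secretary.a (l + 1)))) atTop (𝓝 1)) ∧
    (Real.exp ε * Secretary.a (l + 1) ≠ 1 →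
      Tendsto (fun n : ℕ+ => Secretary.pBound (σ n) l ε δ) atTop
        (𝓝 (Real.exp 1 * δ / (1 - Real.exp ε * Secretary.a (l + 1))))) := by
  refine ⟨fun n hn hln p hp h => Secretary.isDP_pMix hn hl hln hε hδ₀ hp (σ n) h, ?_,
    fun h => Secretary.tendsto_pBound σ δ h⟩
  intro hδ hfreq
  have hpos : 0 < 1 - Real.exp ε * Secretary.a (l + 1) := by
    -- A sequence frequently above `δ` cannot have a limit below `δ`.
    have hle : δ ≤ (1 - Real.exp ε * Secretary.a (l + 1)) / Real.exp 1 := by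
      by_contra! hcon
      exact hfreq (((Secretary.tendsto_r_sub σ l ε).eventually_lt_const hcon).mono
        fun n hn => not_lt.2 hn.le)
    exact (div_pos_iff_of_pos_right (Real.exp_pos 1)).1 (hδ.trans_le hle)
  refine ⟨hpos, ?_⟩
  have hne : Real.exp 1 * δ / (1 - Real.exp ε * Secretary.a (l + 1)) ≠ 0 :=
    (div_pos (mul_pos (Real.exp_pos 1) hδ) hpos).ne'
  have h := (Secretary.tendsto_pBound σ δ (sub_pos.1 hpos).ne).div_const
    (Real.exp 1 * δ / (1 - Real.exp ε * Secretary.a (l + 1)))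
  rwa [div_self hne] at h
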